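/- **Setting.** Let $P$ be a finite set of parameters and $lb,ub:P\to\mathbb Z$. Only parameter valuations $v:P\to\mathbb Z$ in $Val_{lb,ub}=\{v\mid lb(p)\le v(p)\le ub(p)\text{ for all }p\}$ are considered in constraint sets. $E(P)$ is the set of affine expressions $z_0+\sum_p z_p p$ with integer coefficients, $e[v]$ is the value of $e$ under $v$, and $\max_{lb,ub}(e)$ is the value of $e$ with each $p$ replaced by $ub(p)$ if its coefficient is positive and by $lb(p)$ if it is negative. Clocks are $x_0,x_1,\dots,x_n$; a clock valuation is $\eta:\{x_0,\dots,x_n\}\to\mathbb R_{\ge0}$ with $\eta(x_0)=0$. A simple guard is a finite conjunction of conditions $x_i-x_j\sim e$ with $e\in E(P)$, $\sim\in\{\le,<\}$ and $x_i=x_0$ or $x_j=x_0$. A parametric timed Büchi automaton (PTBA) $A$ consists of a finite set $L$ of locations, $l_0\in L$, a finite set $\Delta$ of edges $(l,g,R,l')$ with a simple guard $g$ and a set $R$ of clocks to be reset, invariants $Inv(l)$ (simple guards), and accepting locations $F\subseteq L$. **Concrete semantics** $[\![A]\!]_v$. States are pairs $(l,\eta)$; delay steps $(l,\eta)\xrightarrow{d}(l,\eta+d)$,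 $d\ge0$, if $Inv(l)$ holds at $(v,\eta+d)$; action steps $(l,\eta)\xrightarrow{act}(l',\eta\langle R\rangle)$ if $(l,g,R,l')\in\Delta$, $g$ holds at $(v,\eta)$ and $Inv(l')$ holds at $(v,\eta\langle R\rangle)$. An accepting run is an infinite sequence $s_0\xrightarrow{d_0}s_0'\xrightarrow{act}s_1\xrightarrow{d_1}s_1'\xrightarrow{act}\cdots$ with $s_0=(l_0,\mathbf 0)$ in which the location of $s_i$ is in $F$ for infinitely many $i$. A time-abstracting simulation for $v$ is a relation $R$ between states with the same location such that $s_1Rs_2$ and $s_1\xrightarrow{act}s_1'$ imply $s_2\xrightarrow{act}s_2'$ and $s_1'Rs_2'$ for some $s_2'$, and $s_1Rs_2$ and $s_1\xrightarrow{d_1}s_1'$ imply $s_2\xrightarrow{d_2}s_2'$ and $s_1'Rs_2'$ for some $d_2\geq 0$ and $s_2'$; $s\preccurlyeq s'$ means that $sRs'$ for some such $R$. **CPDBMs.** A constraint is $e\sim e'$ with $e,e'\in E(P)\cup\{\infty\}$, $\sim\in\{\le,<,\ge,>\}$. For a finite set $C$ of constraints, $[\![C]\!]\subseteq Val_{lb,ub}$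 is the set of the valuations that satisfy all of them, and $C\models c$ means that all of these satisfy $c$. A CPDBM is a pair $(C,D)$ with $D_{ij}=(x_i-x_j\prec_{ij}e_{ij})$ for $0\le i,j\le n$, where $\prec_{ij}\in\{\leq,<\}$, $e_{ij}\in E(P)\cup\{\infty\}$, $e_{ii}=0$ and $C\models e_{0i}\le0$; $[\![C,D]\!]=\{(v,\eta)\mid v\in[\![C]\!],\ \eta\text{ satisfies all }D_{ij}\text{ under }v\}$. Identify $\le$ with true and $<$ with false. - *Guard.* For $g=(x_i-x_j\prec e)$ let $c$ be $e_{ij}\,(\prec_{ij}\Rightarrow\prec)\,e$ and let $D[g]$ be $D$ with entry $(i,j)$ replaced by $g$. Then $(C,D)[g]$ is $\{(C,D[g])\}$ if $C\models\neg c$; else $\{(C,D)\}$ if $C\models c$; else $\{(C\cup\{c\},D),(C\cup\{\neg c\},D[g])\}$. Conjunctions are applied one conjunct after another. - *Reset* of $x_r$: for $i\ne j$, row $r$ becomes row $0$ and column $r$ becomes column $0$. *Time successor* $D^\uparrow$: entries $(i,0)$, $i\neq0$, become $<\infty$. - *Canonical set* $(C,D)_c$: all results of the nondeterministic Floyd–Warshall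 algorithm, which for $k,i,j=0,\dots,n$ (three nested loops, $k$ outermost, $j$ innermost) applies the guard $x_i-x_j\,(\prec_{ik}\wedge\prec_{kj})\,e_{ik}+e_{kj}$. **Symbolic semantics** $[\![A]\!]$. $\mathbb S_A$ is the set of all $(l,[\![C,D]\!])$, $l\in L$, $(C,D)$ a CPDBM. Initial states are all $(l_0,[\![C,D]\!])$ with $(C,D)\in(C_0,E^\uparrow)[Inv(l_0)]$, where $C_0=\{lb(p)\le p,\ p\le ub(p)\mid p\in P\}$ and all entries of $E$ are $\le0$. There is a transition $(l,[\![C,D]\!])\Longrightarrow(l',[\![C_4,D_4]\!])$ if, for some edge $(l,g,R,l')$, $(C_1,D_1)\in(C,D)[g]$, $(C_2,D_2)\in(C_1,D_1)_c$, $(C_3,D_3)\in(C_2,D_2\langle R\rangle^\uparrow)[Inv(l')]$ and $(C_4,D_4)\in(C_3,D_3)_c$. For $S=(l,Z)\in\mathbb S_A$ let $S_v=\{(l,\eta)\mid(v,\eta)\in Z\}$ and $par(S)=\{v\mid S_v\neq\emptyset\}$. **Abstractions.** A map $\alpha:\mathbb S_A\to2^{\mathbb S_A}$ is an abstraction if for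 all $S\in\mathbb S_A$: (i) each $S'\in\alpha(S)$ has the location of $S$, $par(S')\subseteq par(S)$, and $S_v\subseteq S'_v$ for all $v\in par(S')$; (ii) for each $v\in par(S)$ there is $S'\in\alpha(S)$ with $v\in par(S')$; (iii) for all $S'\in\alpha(S)$, all $v$ and all $s\in S'_v$ there is $s'\in S_v$ with $s\preccurlyeq s'$. It is finite if its image and the set $\mathbb Q_A=\bigcup_{S\in\mathbb S_A}\alpha(S)$ are finite. The abstract system $[\![A]\!]^\alpha$ has the states $\mathbb Q_A$, the initial states $\bigcup\alpha(S)$ over initial $S$, and $Q\Longrightarrow^\alpha Q'$ iff $Q\Longrightarrow S$ and $Q'\in\alpha(S)$ for some $S\in\mathbb S_A$. An accepting run of it is an infinite path from an initial state that visits states with locations in $F$ infinitely often; the run respects $v$ if $v\in par(Q)$ for all its states $Q$. **pk-extrapolation.** For $i\ge1$ let $M(x_i)$ be the maximum of $0$, all $\max_{lb,ub}(e)$ with $x_i-x_0\sim e$ in a guard or invariant of $A$, and all $\max_{lb,ub}(-e)$ with $x_0-x_i\sim e$ in a guard or invariant of $A$; let $M(x_0)=0$. $\alpha_{pk}(l,Z)$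 is the set of all $(l,[\![C',D']\!])$ obtained as follows: take a CPDBM with semantics $Z$, take $(C,D)$ in its canonical set, and for each $(i,j)$ choose one of: keep $D_{ij}$ and add the constraints $-M(x_j)\le e_{ij}$ and $e_{ij}\le M(x_i)$ to $C$; replace $D_{ij}$ by $x_i-x_j<\infty$ and add $e_{ij}>M(x_i)$; replace $D_{ij}$ by $x_i-x_j<-M(x_j)$ and add $e_{ij}<-M(x_j)$. **Theorem.** For every PTBA $A$ and all $lb,ub$, $\alpha_{pk}$ is a finite abstraction. Moreover, for every $v\in Val_{lb,ub}$: 1. if $[\![A]\!]_v$ has an accepting run, then $[\![A]\!]^{\alpha_{pk}}$ has an accepting run respecting $v$; 2. if $[\![A]\!]^{\alpha_{pk}}$ has an accepting run respecting $v$, then $[\![A]\!]_v$ has an accepting run, provided that under $v$ no edge leads into a violated invariant that becomes true later by waiting: for every edge $(l,g,R,l')$, every $\eta$ satisfying $Inv(l)$ and $g$ and every $d\ge0$, if $Inv(l')$ holds at $\eta\langle R\rangle+d$ then it holds at $\eta\langle R\rangle$. (This is automatic if invariants contain only upper bounds on clocks.) So, under this proviso, $[\![A]\!]_v$ has an accepting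 run if and only if $[\![A]\!]^{\alpha_{pk}}$ has an accepting run respecting $v$. -/

import Mathlib

open scoped NNReal

namespace ParTimed

/-! ### Affine expressions, parameter valuations, constraints -/

/-- An affine expression `z₀ + ∑ p, z_p * p` with integer coefficients over the parameters `P`. -/
structure AffExpr (P : Type*) where
  const : ℤ
  coeff : P → ℤ

instance {P : Type*} : Zero (AffExpr P) := ⟨⟨0, fun _ => 0⟩⟩

instance {P : Type*} : Add (AffExpr P) :=
  ⟨fun e f => ⟨e.const + f.const, fun p => e.coeff p + f.coeff p⟩⟩

instance {P : Type*} : Neg (AffExpr P) := ⟨fun e => ⟨-e.const, fun p => -e.coeff p⟩⟩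

/-- The constant expression `z`. -/
def AffExpr.ofInt {P : Type*} (z : ℤ) : AffExpr P := ⟨z, fun _ => 0⟩

open Classical in
/-- The expression consisting of a single parameter. -/
noncomputable def AffExpr.param {P : Type*} (p : P) : AffExpr P :=
  ⟨0, fun q => if q = p then 1 else 0⟩

/-- The value `e[v]`. -/
def AffExpr.eval {P : Type*} [Fintype P] (e : AffExpr P) (v : P → ℤ) : ℤ :=
  e.const + ∑ p, e.coeff p * v p

/-- `max_{lb,ub}(e)`: parameters with a positive coefficient are replaced by their upper bound,
those with a negative coefficient by their lower bound. -/
def AffExpr.maxVal {P : Type*} [Fintype P] (lb ub : P → ℤ) (e : AffExpr P) : ℤ :=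
  e.const + ∑ p, e.coeff p * (if 0 < e.coeff p then ub p else lb p)

/-- The set of the parameter valuations that respect `lb` and `ub`. -/
def Val {P : Type*} (lb ub : P → ℤ) : Set (P → ℤ) := {v | ∀ p, lb p ≤ v p ∧ v p ≤ ub p}

/-- An element of `E(P) ∪ {∞}`. -/
abbrev ExtExpr (P : Type*) := WithTop (AffExpr P)

def ExtExpr.eval {P : Type*} [Fintype P] (e : ExtExpr P) (v : P → ℤ) : WithTop ℤ :=
  WithTop.map (fun f : AffExpr P => f.eval v) e

/-- The integer `z`, seen as an element of `E(P) ∪ {∞}`. -/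
def ExtExpr.ofInt {P : Type*} (z : ℤ) : ExtExpr P := ((AffExpr.ofInt z : AffExpr P) : WithTop _)

/-- The relation symbols `≤` and `<`, identified with the truth values `true` and `false`. -/
def Rel {α : Type*} [LE α] [LT α] (r : Bool) (a b : α) : Prop := if r then a ≤ b else a < b

/-- A constraint `lhs ∼ rhs`, where `∼` is `≤` (`rel = true`) or `<` (`rel = false`);
`≥` and `>` are obtained by exchanging the two sides. -/
structure Constraint (P : Type*) where
  lhs : ExtExpr P
  rel : Bool
  rhs : ExtExpr P

def Constraint.Sat {P : Type*} [Fintype P] (c : Constraint P) (v : P → ℤ) : Prop :=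
  Rel c.rel (ExtExpr.eval c.lhs v) (ExtExpr.eval c.rhs v)

/-- The negation of a constraint, again a constraint. -/
def Constraint.neg {P : Type*} (c : Constraint P) : Constraint P := ⟨c.rhs, !c.rel, c.lhs⟩

/-- The semantics of a constraint set; only valuations that respect `lb` and `ub` are considered. -/
def semC {P : Type*} [Fintype P] (lb ub : P → ℤ) (C : Finset (Constraint P)) : Set (P → ℤ) :=
  {v | v ∈ Val lb ub ∧ ∀ c ∈ C, c.Sat v}

/-- `C ⊨ c`. -/
def Covers {P : Type*} [Fintype P] (lb ub : P → ℤ) (C : Finset (Constraint P))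
    (c : Constraint P) : Prop :=
  ∀ v ∈ semC lb ub C, c.Sat v

/-! ### Clocks and parametric timed Büchi automata

The clocks are `x_0, x_1, …, x_n`, indexed by `Fin (n + 1)`; `x_0` is the zero clock. -/

/-- Clock valuations. -/
def ClockVal (n : ℕ) : Type := {η : Fin (n + 1) → ℝ≥0 // η 0 = 0}

/-- The valuation `η + d`. -/
def ClockVal.delay {n : ℕ} (η : ClockVal n) (d : ℝ≥0) : ClockVal n :=
  ⟨fun x => if x = 0 then 0 else η.1 x + d, by simp⟩

/-- The valuation `η⟨R⟩`. -/
def ClockVal.reset {n : ℕ} (η : ClockVal n) (R : Finset (Fin (n + 1))) : ClockVal n :=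
  ⟨fun x => if x ∈ R then 0 else η.1 x, by simp [η.2]⟩

/-- The valuation that is constantly `0`. -/
def ClockVal.zero (n : ℕ) : ClockVal n := ⟨fun _ => 0, rfl⟩

/-- A conjunct `x_i - x_j ∼ e` of a simple guard: `x_i` or `x_j` is the zero clock. -/
structure SimpleAtom (n : ℕ) (P : Type*) where
  i : Fin (n + 1)
  j : Fin (n + 1)
  rel : Bool
  expr : AffExpr P
  simple : i = 0 ∨ j = 0

def SimpleAtom.Sat {n : ℕ} {P : Type*} [Fintype P] (a : SimpleAtom n P) (v : P → ℤ)
    (η : ClockVal n) : Prop :=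
  Rel a.rel ((η.1 a.i : ℝ) - (η.1 a.j : ℝ)) ((a.expr.eval v : ℤ) : ℝ)

/-- A simple guard, a finite conjunction. -/
abbrev SimpleGuard (n : ℕ) (P : Type*) := List (SimpleAtom n P)

/-- `(v, η) ⊨ g`. -/
def SimpleGuard.Sat {n : ℕ} {P : Type*} [Fintype P] (g : SimpleGuard n P) (v : P → ℤ)
    (η : ClockVal n) : Prop :=
  ∀ a ∈ g, a.Sat v η

/-- Parametric timed automata. -/
structure PTA (L P : Type*) (n : ℕ) where
  init : L
  edges : Set (L × SimpleGuard n P × Finset (Fin (n + 1)) × L)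
  edges_finite : edges.Finite
  inv : L → SimpleGuard n P

/-- Parametric timed Büchi automata. -/
structure PTBA (L P : Type*) (n : ℕ) extends PTA L P n where
  acc : Set L

/-! ### Concrete semantics -/

/-- Concrete states. -/
abbrev State (L : Type*) (n : ℕ) := L × ClockVal n

/-- Delay transitions of the semantics under `v`. -/
def PTBA.Delay {L P : Type*} [Fintype P] {n : ℕ} (A : PTBA L P n) (v : P → ℤ) (d : ℝ≥0)
    (s s' : State L n) : Prop :=
  s.1 = s'.1 ∧ s'.2 = s.2.delay d ∧ (A.inv s'.1).Sat v s'.2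

/-- Action transitions of the semantics under `v`. -/
def PTBA.Act {L P : Type*} [Fintype P] {n : ℕ} (A : PTBA L P n) (v : P → ℤ)
    (s s' : State L n) : Prop :=
  ∃ g R, (s.1, g, R, s'.1) ∈ A.edges ∧ g.Sat v s.2 ∧ s'.2 = s.2.reset R ∧
    (A.inv s'.1).Sat v s'.2

/-- There is an accepting proper run
`s 0 -d 0-> s' 0 -act-> s 1 -d 1-> s' 1 -act-> …` of the semantics under `v`. -/
def PTBA.HasAcceptingRun {L P : Type*} [Fintype P] {n : ℕ} (A : PTBA L P n) (v : P → ℤ) : Prop :=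
  ∃ (s s' : ℕ → State L n) (d : ℕ → ℝ≥0),
    s 0 = (A.init, ClockVal.zero n) ∧
    (∀ k, A.Delay v (d k) (s k) (s' k)) ∧
    (∀ k, A.Act v (s' k) (s (k + 1))) ∧
    {k | (s k).1 ∈ A.acc}.Infinite

/-- Time-abstracting simulations on the semantics under `v`. Action transitions carry their source
location as a label, so related states have the same location. -/
def PTBA.IsTimeAbstractSim {L P : Type*} [Fintype P] {n : ℕ} (A : PTBA L P n) (v : P → ℤ)
    (R : State L n → State L n → Prop) : Prop :=
  (∀ s₁ s₂, R s₁ s₂ → s₁.1 = s₂.1) ∧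
  (∀ s₁ s₂ s₁', R s₁ s₂ → A.Act v s₁ s₁' → ∃ s₂', A.Act v s₂ s₂' ∧ R s₁' s₂') ∧
  (∀ s₁ s₂ s₁' d₁, R s₁ s₂ → A.Delay v d₁ s₁ s₁' → ∃ d₂ s₂', A.Delay v d₂ s₂ s₂' ∧ R s₁' s₂')

/-- The largest time-abstracting simulation `s ≼ s'`. -/
def PTBA.Simulated {L P : Type*} [Fintype P] {n : ℕ} (A : PTBA L P n) (v : P → ℤ)
    (s s' : State L n) : Prop :=
  ∃ R, A.IsTimeAbstractSim v R ∧ R s s'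

/-! ### Constrained parametric difference bound matrices -/

/-- A bound `≺ e` with `e ∈ E(P) ∪ {∞}`. -/
structure Bound (P : Type*) where
  rel : Bool
  expr : ExtExpr P

/-- The real number `r` satisfies the bound under `v`. -/
def Bound.Sat {P : Type*} [Fintype P] (b : Bound P) (v : P → ℤ) (r : ℝ) : Prop :=
  match b.expr with
  | none => True
  | some e => Rel b.rel r ((e.eval v : ℤ) : ℝ)

/-- Matrices of bounds, the entry `D i j` being the bound on `x_i - x_j`. -/
abbrev PMatrix (n : ℕ) (P : Type*) := Fin (n + 1) → Fin (n + 1) → Bound P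

/-- A constraint set together with a matrix of bounds. -/
structure CMatrix (n : ℕ) (P : Type*) where
  C : Finset (Constraint P)
  D : PMatrix n P

/-- `(C, D)` is a CPDBM: the diagonal expressions are `0`, and `C ⊨ e_{0i} ≤ 0` for all `i`
(clocks are non-negative). -/
def CMatrix.IsCPDBM {n : ℕ} {P : Type*} [Fintype P] (lb ub : P → ℤ) (Z : CMatrix n P) : Prop :=
  (∀ i, (Z.D i i).expr = ((0 : AffExpr P) : WithTop _)) ∧
  ∀ i, Covers lb ub Z.C ⟨(Z.D 0 i).expr, true, ExtExpr.ofInt 0⟩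

/-- The semantics of `(C, D)`. -/
def CMatrix.sem {n : ℕ} {P : Type*} [Fintype P] (lb ub : P → ℤ) (Z : CMatrix n P) :
    Set ((P → ℤ) × ClockVal n) :=
  {x | x.1 ∈ semC lb ub Z.C ∧
    ∀ i j, (Z.D i j).Sat x.1 ((x.2.1 i : ℝ) - (x.2.1 j : ℝ))}

/-- Reset of the clock `x_r`. -/
def PMatrix.reset {n : ℕ} {P : Type*} (D : PMatrix n P) (r : Fin (n + 1)) : PMatrix n P :=
  fun i j => if i ≠ j ∧ i = r then D 0 j else if i ≠ j ∧ j = r then D i 0 else D i j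

/-- Reset of a set of clocks, one clock after another. -/
def PMatrix.resets {n : ℕ} {P : Type*} (D : PMatrix n P) (R : Finset (Fin (n + 1))) :
    PMatrix n P :=
  R.sort.foldl PMatrix.reset D

/-- Time successor: all upper bounds on clocks are removed. -/
def PMatrix.up {n : ℕ} {P : Type*} (D : PMatrix n P) : PMatrix n P :=
  fun i j => if i ≠ 0 ∧ j = 0 then ⟨false, ⊤⟩ else D i j

/-- The matrix `D[g]` for `g` of the form `x_i - x_j ≺ e`. -/
def PMatrix.set {n : ℕ} {P : Type*} (D : PMatrix n P) (i j : Fin (n + 1)) (b : Bound P) :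
    PMatrix n P :=
  fun k l => if k = i ∧ l = j then b else D k l

open Classical in
/-- Application of the guard `x_i - x_j ≺ e`. The constraint `c` says that the present bound
on `x_i - x_j` is at least as tight as the new one. -/
noncomputable def CMatrix.apply {n : ℕ} {P : Type*} [Fintype P] (lb ub : P → ℤ) (Z : CMatrix n P)
    (i j : Fin (n + 1)) (b : Bound P) : Set (CMatrix n P) :=
  let c : Constraint P := ⟨(Z.D i j).expr, !(Z.D i j).rel || b.rel, b.expr⟩
  if Covers lb ub Z.C c.neg then {⟨Z.C, Z.D.set i j b⟩}
  else if Covers lb ub Z.C c then {Z}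
  else {⟨insert c Z.C, Z.D⟩, ⟨insert c.neg Z.C, Z.D.set i j b⟩}

/-- Application of a conjunction of atomic guards, one after another. -/
def CMatrix.applyGuard {n : ℕ} {P : Type*} [Fintype P] (lb ub : P → ℤ) :
    SimpleGuard n P → CMatrix n P → Set (CMatrix n P)
  | [], Z => {Z}
  | a :: g, Z => {Z'' | ∃ Z' ∈ Z.apply lb ub a.i a.j ⟨a.rel, (a.expr : WithTop _)⟩,
      Z'' ∈ CMatrix.applyGuard lb ub g Z'}

/-- One step of the nondeterministic Floyd-Warshall algorithm, on configurations
`(k, i, j, (C, D))`. -/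
inductive FWStep {n : ℕ} {P : Type*} [Fintype P] (lb ub : P → ℤ) :
    ℕ × ℕ × ℕ × CMatrix n P → ℕ × ℕ × ℕ × CMatrix n P → Prop
  | relax (k i j : Fin (n + 1)) (Z Z' : CMatrix n P)
      (h : Z' ∈ Z.apply lb ub i j
        ⟨(Z.D i k).rel && (Z.D k j).rel, (Z.D i k).expr + (Z.D k j).expr⟩) :
      FWStep lb ub ((k : ℕ), (i : ℕ), (j : ℕ), Z) ((k : ℕ), (i : ℕ), (j : ℕ) + 1, Z')
  | nextRow (k i : Fin (n + 1)) (Z : CMatrix n P) :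
      FWStep lb ub ((k : ℕ), (i : ℕ), n + 1, Z) ((k : ℕ), (i : ℕ) + 1, 0, Z)
  | nextPivot (k : Fin (n + 1)) (Z : CMatrix n P) :
      FWStep lb ub ((k : ℕ), n + 1, 0, Z) ((k : ℕ) + 1, 0, 0, Z)

/-- The canonical set `(C, D)_c`. -/
def CMatrix.canon {n : ℕ} {P : Type*} [Fintype P] (lb ub : P → ℤ) (Z : CMatrix n P) :
    Set (CMatrix n P) :=
  {Z' | Relation.ReflTransGen (FWStep lb ub) (0, 0, 0, Z) (n + 1, 0, 0, Z')}

/-! ### Symbolic semantics -/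

/-- A location with a set of pairs (parameter valuation, clock valuation). -/
structure SymState (L P : Type*) (n : ℕ) where
  loc : L
  zone : Set ((P → ℤ) × ClockVal n)

/-- The set of all symbolic states: the zone is the semantics of a CPDBM. -/
def symStates (L : Type*) {P : Type*} [Fintype P] (n : ℕ) (lb ub : P → ℤ) :
    Set (SymState L P n) :=
  {S | ∃ Z : CMatrix n P, Z.IsCPDBM lb ub ∧ S.zone = Z.sem lb ub}

/-- The set `⟦C⟧` of the parameter valuations of a symbolic state `(l, ⟦C, D⟧)`. -/
def SymState.params {L P : Type*} {n : ℕ} (S : SymState L P n) : Set (P → ℤ) :=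
  {v | ∃ η, (v, η) ∈ S.zone}

/-- `s ∈_v S`. -/
def SymState.Contains {L P : Type*} {n : ℕ} (S : SymState L P n) (v : P → ℤ) (s : State L n) :
    Prop :=
  s.1 = S.loc ∧ (v, s.2) ∈ S.zone

open Classical in
/-- The constraints `lb p ≤ p` and `p ≤ ub p`. -/
noncomputable def boundConstraints {P : Type*} [Fintype P] (lb ub : P → ℤ) :
    Finset (Constraint P) :=
  Finset.univ.image (fun p => ⟨ExtExpr.ofInt (lb p), true, (AffExpr.param p : WithTop _)⟩) ∪
  Finset.univ.image (fun p => ⟨(AffExpr.param p : WithTop _), true, ExtExpr.ofInt (ub p)⟩)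

/-- The matrix `E` all whose entries are `≤ 0`. -/
def zeroMatrix (n : ℕ) (P : Type*) : PMatrix n P := fun _ _ => ⟨true, ExtExpr.ofInt 0⟩

/-- The initial symbolic states. -/
def PTBA.symInit {L P : Type*} [Fintype P] {n : ℕ} (A : PTBA L P n) (lb ub : P → ℤ) :
    Set (SymState L P n) :=
  {S | S.loc = A.init ∧
    ∃ Z ∈ CMatrix.applyGuard lb ub (A.inv A.init)
      ⟨boundConstraints lb ub, (zeroMatrix n P).up⟩, S.zone = Z.sem lb ub}

/-- The transitions of the symbolic semantics. -/
def PTBA.SymTrans {L P : Type*} [Fintype P] {n : ℕ} (A : PTBA L P n) (lb ub : P → ℤ)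
    (S S' : SymState L P n) : Prop :=
  ∃ Z : CMatrix n P, Z.IsCPDBM lb ub ∧ S.zone = Z.sem lb ub ∧
    ∃ g R, (S.loc, g, R, S'.loc) ∈ A.edges ∧
      ∃ Z₁ ∈ CMatrix.applyGuard lb ub g Z,
      ∃ Z₂ ∈ Z₁.canon lb ub,
      ∃ Z₃ ∈ CMatrix.applyGuard lb ub (A.inv S'.loc) ⟨Z₂.C, (Z₂.D.resets R).up⟩,
      ∃ Z₄ ∈ Z₃.canon lb ub,
        S'.zone = Z₄.sem lb ub

/-! ### Abstractions -/

/-- `α` is an abstraction over the symbolic semantics of `A`. -/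
def PTBA.IsAbstraction {L P : Type*} [Fintype P] {n : ℕ} (A : PTBA L P n) (lb ub : P → ℤ)
    (α : SymState L P n → Set (SymState L P n)) : Prop :=
  ∀ S ∈ symStates L n lb ub,
    α S ⊆ symStates L n lb ub ∧
    (∀ S' ∈ α S, S'.loc = S.loc ∧ S'.params ⊆ S.params ∧
      ∀ v ∈ S'.params, ∀ η, (v, η) ∈ S.zone → (v, η) ∈ S'.zone) ∧
    (∀ v ∈ S.params, ∃ S' ∈ α S, v ∈ S'.params) ∧
    (∀ S' ∈ α S, ∀ v s, S'.Contains v s → ∃ s', S.Contains v s' ∧ A.Simulated v s s')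

/-- The set `ℚ_A` of the states of the abstract transition system. -/
def absStates {L P : Type*} [Fintype P] {n : ℕ} (lb ub : P → ℤ)
    (α : SymState L P n → Set (SymState L P n)) : Set (SymState L P n) :=
  {Q | ∃ S ∈ symStates L n lb ub, Q ∈ α S}

/-- The initial states of the abstract transition system. -/
def PTBA.absInit {L P : Type*} [Fintype P] {n : ℕ} (A : PTBA L P n) (lb ub : P → ℤ)
    (α : SymState L P n → Set (SymState L P n)) : Set (SymState L P n) :=
  {Q | ∃ S ∈ A.symInit lb ub, Q ∈ α S}

/-- The transitions of the abstract transition system. -/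
def PTBA.AbsTrans {L P : Type*} [Fintype P] {n : ℕ} (A : PTBA L P n) (lb ub : P → ℤ)
    (α : SymState L P n → Set (SymState L P n)) (Q Q' : SymState L P n) : Prop :=
  ∃ S ∈ symStates L n lb ub, Q' ∈ α S ∧ A.SymTrans lb ub Q S

/-- `α` is a finite abstraction: its image is finite and the abstract transition system has
finitely many states. -/
def PTBA.IsFiniteAbstraction {L P : Type*} [Fintype P] {n : ℕ} (A : PTBA L P n) (lb ub : P → ℤ)
    (α : SymState L P n → Set (SymState L P n)) : Prop :=
  A.IsAbstraction lb ub α ∧ (α '' symStates L n lb ub).Finite ∧ (absStates lb ub α).Finite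

/-- The abstract transition system has an accepting run that respects `v`. -/
def PTBA.AbsHasAcceptingRun {L P : Type*} [Fintype P] {n : ℕ} (A : PTBA L P n) (lb ub : P → ℤ)
    (α : SymState L P n → Set (SymState L P n)) (v : P → ℤ) : Prop :=
  ∃ Q : ℕ → SymState L P n,
    Q 0 ∈ A.absInit lb ub α ∧
    (∀ k, Q k ∈ absStates lb ub α) ∧
    (∀ k, A.AbsTrans lb ub α (Q k) (Q (k + 1))) ∧
    (∀ k, v ∈ (Q k).params) ∧
    {k | (Q k).loc ∈ A.acc}.Infinite

/-! ### The pk-extrapolation -/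

/-- The conjuncts of the guards and invariants of `A`. -/
def PTBA.atoms {L P : Type*} {n : ℕ} (A : PTBA L P n) : Set (SimpleAtom n P) :=
  {a | (∃ t ∈ A.edges, a ∈ t.2.1) ∨ ∃ l, a ∈ A.inv l}

/-- The maximal values of the expressions with which the clock `x` is compared in `A`:
`x ≺ e` compares `x` with `e`, and `-x ≺ e` compares `x` with `-e`. -/
def PTBA.comparedConsts {L P : Type*} [Fintype P] {n : ℕ} (A : PTBA L P n) (lb ub : P → ℤ)
    (x : Fin (n + 1)) : Set ℤ :=
  {m | x ≠ 0 ∧ ∃ a ∈ A.atoms, (a.i = x ∧ a.j = 0 ∧ m = a.expr.maxVal lb ub) ∨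
    (a.i = 0 ∧ a.j = x ∧ m = (-a.expr).maxVal lb ub)}

/-- `M(x)`, the maximum of `0` and of the finitely many values with which `x` is compared. -/
noncomputable def PTBA.maxConst {L P : Type*} [Fintype P] {n : ℕ} (A : PTBA L P n)
    (lb ub : P → ℤ) (x : Fin (n + 1)) : ℤ :=
  sSup (insert 0 (A.comparedConsts lb ub x))

/-- What happens to a bound on `x_i - x_j` under extrapolation. -/
inductive PkCase
  | keep
  | drop
  | clip

/-- The new bound on `x_i - x_j` when the old one is `b`. -/
def pkBound {n : ℕ} {P : Type*} (M : Fin (n + 1) → ℤ) (j : Fin (n + 1)) (b : Bound P) :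
    PkCase → Bound P
  | .keep => b
  | .drop => ⟨false, ⊤⟩
  | .clip => ⟨false, ExtExpr.ofInt (-M j)⟩

open Classical in
/-- The constraints under which the bound `b` on `x_i - x_j` is treated in the given way:
`-M(x_j) ≤ e ≤ M(x_i)`, `e > M(x_i)` and `e < -M(x_j)`, respectively. -/
noncomputable def pkConstraints {n : ℕ} {P : Type*} (M : Fin (n + 1) → ℤ) (i j : Fin (n + 1))
    (b : Bound P) : PkCase → Finset (Constraint P)
  | .keep => {⟨b.expr, true, ExtExpr.ofInt (M i)⟩, ⟨ExtExpr.ofInt (-M j), true, b.expr⟩}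
  | .drop => {⟨ExtExpr.ofInt (M i), false, b.expr⟩}
  | .clip => {⟨b.expr, false, ExtExpr.ofInt (-M j)⟩}

open Classical in
/-- Extrapolation of `(C, D)`: one of the three cases is selected for every entry of `D`, and the
corresponding constraints are added to `C`. -/
noncomputable def CMatrix.pkSplit {n : ℕ} {P : Type*} (M : Fin (n + 1) → ℤ) (Z : CMatrix n P) :
    Set (CMatrix n P) :=
  {Z' | ∃ κ : Fin (n + 1) → Fin (n + 1) → PkCase,
    Z' = ⟨Z.C ∪ Finset.univ.biUnion (fun ij : Fin (n + 1) × Fin (n + 1) =>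
        pkConstraints M ij.1 ij.2 (Z.D ij.1 ij.2) (κ ij.1 ij.2)),
      fun i j => pkBound M j (Z.D i j) (κ i j)⟩}

/-- The pk-extrapolation `α_pk`; a CPDBM representing the state is brought into canonical form
before its bounds are extrapolated (if it is in canonical form, this does not change it). -/
def PTBA.pkExtrapolation {L P : Type*} [Fintype P] {n : ℕ} (A : PTBA L P n) (lb ub : P → ℤ)
    (S : SymState L P n) : Set (SymState L P n) :=
  {S' | S'.loc = S.loc ∧ ∃ Z : CMatrix n P, Z.IsCPDBM lb ub ∧ S.zone = Z.sem lb ub ∧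
    ∃ Z₁ ∈ Z.canon lb ub, ∃ Z₂ ∈ Z₁.pkSplit (A.maxConst lb ub), S'.zone = Z₂.sem lb ub}

/-! ### Invariants -/

/-- Under `v`, a clock valuation that violates the invariant of the target location right after an edge has
been taken cannot come to satisfy it by letting time pass. (This is the case, in particular, if
all conjuncts of the invariants are upper bounds on clocks.) -/
def PTBA.InvariantsHoldOnEntry {L P : Type*} [Fintype P] {n : ℕ} (A : PTBA L P n)
    (v : P → ℤ) : Prop :=
  ∀ l g R l', (l, g, R, l') ∈ A.edges → ∀ (η : ClockVal n) (d : ℝ≥0),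
    (A.inv l).Sat v η → g.Sat v η → (A.inv l').Sat v ((η.reset R).delay d) →
      (A.inv l').Sat v (η.reset R)

end ParTimed

namespace ParTimed

open scoped Pointwise

variable {P : Type*} [Fintype P] {n : ℕ} {lb ub v : P → ℤ}

/-! ### Affine expressions and constraints -/

/-! The argument works one parameter valuation `v` at a time. Under a fixed `v` every bound is a
nonempty lower set of reals (`Bound.sols`), and a matrix of bounds is a matrix of such sets
(`CMatrix.slice`). The splitting of constraint sets then becomes invisible: on a branch that
contains `v`, applying a guard just intersects one entry with a half-line
(`CMatrix.slice_of_mem_apply`), and Floyd-Warshall intersects entries with Minkowski sums of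
entries. Its results are closed under composition as long as `0` lies in every diagonal entry
(`CMatrix.triangle_of_mem_canon`).

In a closed system every partial solution extends to a full one, by Helly's theorem on the line
(`Triangle.exists_extension`). This is used three times: to recover the clock values erased by a
reset (`CMatrix.exists_reset_delay`), to match a delay between related valuations
(`RegionLE.delay`), and to move a valuation of an extrapolated zone back into the original zone
(`CMatrix.exists_mem_sem_of_mem_pkSplit`). The last move keeps all clocks that are at most `M` and
leaves the others above `M`. The two valuations are thus related by `RegionLE`, which is a
time-abstracting simulation. Finiteness holds because there are finitely many `v`, and because the
bounds that survive extrapolation have integer end points in a bounded range.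

A concrete run is followed forwards by an abstract one. An abstract run is read backwards: each
valuation in a symbolic successor has a predecessor, which gives concrete runs of every finite
length along the path. As there are finitely many regions, the pigeonhole principle turns these into
an infinite run (`exists_infinite_run`). The proviso on invariants is needed because a symbolic step
tests the target invariant only after the delay. -/

theorem AffExpr.eval_add (e f : AffExpr P) (v : P → ℤ) : (e + f).eval v = e.eval v + f.eval v := by
  change e.const + f.const + ∑ p, (e.coeff p + f.coeff p) * v p = _
  simp only [AffExpr.eval, add_mul, Finset.sum_add_distrib]
  ring

theorem AffExpr.eval_neg (e : AffExpr P) (v : P → ℤ) : (-e).eval v = -e.eval v := by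
  change -e.const + ∑ p, (-e.coeff p) * v p = _
  simp only [AffExpr.eval, neg_mul, Finset.sum_neg_distrib]
  ring

@[simp] theorem AffExpr.eval_ofInt (z : ℤ) (v : P → ℤ) : (AffExpr.ofInt z).eval v = z := by
  simp [AffExpr.eval, AffExpr.ofInt]

@[simp] theorem AffExpr.eval_param (p : P) (v : P → ℤ) : (AffExpr.param p).eval v = v p := by
  classical
  simp only [AffExpr.eval, AffExpr.param, zero_add]
  rw [Finset.sum_eq_single p] <;> simp +contextual

theorem AffExpr.eval_le_maxVal (e : AffExpr P) (hv : v ∈ Val lb ub) :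
    e.eval v ≤ e.maxVal lb ub := by
  unfold AffExpr.eval AffExpr.maxVal
  refine add_le_add le_rfl (Finset.sum_le_sum fun p _ => ?_)
  split_ifs with h
  · exact mul_le_mul_of_nonneg_left (hv p).2 h.le
  · exact mul_le_mul_of_nonpos_left (hv p).1 (not_lt.1 h)

@[simp] theorem ExtExpr.eval_coe (e : AffExpr P) (v : P → ℤ) :
    ExtExpr.eval (e : WithTop (AffExpr P)) v = ((e.eval v : ℤ) : WithTop ℤ) := rfl

@[simp] theorem ExtExpr.eval_top (v : P → ℤ) :
    ExtExpr.eval (⊤ : WithTop (AffExpr P)) v = ⊤ := rfl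

@[simp] theorem ExtExpr.eval_ofInt (z : ℤ) (v : P → ℤ) :
    ExtExpr.eval (ExtExpr.ofInt z) v = (z : WithTop ℤ) := by
  simp [ExtExpr.ofInt]

theorem Constraint.neg_sat (c : Constraint P) : c.neg.Sat v ↔ ¬ c.Sat v := by
  rcases c with ⟨a, r, b⟩
  cases r <;> simp [Constraint.neg, Constraint.Sat, Rel]

theorem semC_insert [DecidableEq (Constraint P)] {C : Finset (Constraint P)} {c : Constraint P} :
    v ∈ semC lb ub (insert c C) ↔ c.Sat v ∧ v ∈ semC lb ub C := by
  simp only [semC, Set.mem_ofPred_eq, Finset.mem_insert, forall_eq_or_imp]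
  tauto

theorem semC_union [DecidableEq (Constraint P)] {C C' : Finset (Constraint P)} :
    v ∈ semC lb ub (C ∪ C') ↔ v ∈ semC lb ub C ∧ ∀ c ∈ C', c.Sat v := by
  simp only [semC, Set.mem_ofPred_eq, Finset.mem_union, or_imp, forall_and]
  tauto

/-! ### Solution sets of bounds -/

/-- The set of the reals that satisfy a bound under `v`. -/
def Bound.sols (b : Bound P) (v : P → ℤ) : Set ℝ := {r | b.Sat v r}

theorem Bound.sols_top (s : Bool) : (⟨s, ⊤⟩ : Bound P).sols v = Set.univ := by
  ext r; exact iff_of_true trivial trivial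

theorem Bound.sols_le (e : AffExpr P) :
    (⟨true, (e : WithTop _)⟩ : Bound P).sols v = Set.Iic ((e.eval v : ℤ) : ℝ) := by
  ext r; simp [Bound.sols, Bound.Sat, Rel]

theorem Bound.sols_lt (e : AffExpr P) :
    (⟨false, (e : WithTop _)⟩ : Bound P).sols v = Set.Iio ((e.eval v : ℤ) : ℝ) := by
  ext r; simp [Bound.sols, Bound.Sat, Rel]

/-- Induction on the three shapes of bounds. -/
theorem Bound.shapes {Q : Type*} {p : Bound Q → Prop} (top : ∀ s, p ⟨s, ⊤⟩)
    (le : ∀ e : AffExpr Q, p ⟨true, (e : WithTop _)⟩)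
    (lt : ∀ e : AffExpr Q, p ⟨false, (e : WithTop _)⟩) (b : Bound Q) : p b := by
  rcases b with ⟨s, e⟩
  cases e with
  | none => exact top s
  | some e => cases s; exacts [lt e, le e]

/-- Lower sets of reals are totally ordered by inclusion. Together with non-emptiness, this is what
the Floyd-Warshall and Helly arguments below use about the shape of bounds. -/
theorem Bound.isLowerSet_sols (b : Bound P) : IsLowerSet (b.sols v) := by
  induction b using Bound.shapes with
  | top s => rw [Bound.sols_top]; exact isLowerSet_univ
  | le e => rw [Bound.sols_le]; exact isLowerSet_Iic _
  | lt e => rw [Bound.sols_lt]; exact isLowerSet_Iio _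

theorem Bound.sols_nonempty (b : Bound P) : (b.sols v).Nonempty := by
  induction b using Bound.shapes with
  | top s => rw [Bound.sols_top]; exact Set.univ_nonempty
  | le e => rw [Bound.sols_le]; exact Set.nonempty_Iic
  | lt e => rw [Bound.sols_lt]; exact Set.nonempty_Iio

theorem Iio_add_Iio (a b : ℝ) : Set.Iio a + Set.Iio b = Set.Iio (a + b) := by
  ext r
  simp only [Set.mem_add, Set.mem_Iio]
  constructor
  · rintro ⟨x, hx, y, hy, rfl⟩; linarith
  · intro h; exact ⟨a - (a + b - r) / 2, by linarith, b - (a + b - r) / 2, by linarith, by ring⟩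

theorem Iic_add_Iio (a b : ℝ) : Set.Iic a + Set.Iio b = Set.Iio (a + b) := by
  ext r
  simp only [Set.mem_add, Set.mem_Iio, Set.mem_Iic]
  constructor
  · rintro ⟨x, hx, y, hy, rfl⟩; linarith
  · intro h; exact ⟨a, le_rfl, r - a, by linarith, by ring⟩

theorem Iic_add_Iic (a b : ℝ) : Set.Iic a + Set.Iic b = Set.Iic (a + b) := by
  ext r
  simp only [Set.mem_add, Set.mem_Iic]
  constructor
  · rintro ⟨x, hx, y, hy, rfl⟩; linarith
  · intro h; exact ⟨a, le_rfl, r - a, by linarith, by ring⟩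

/-- Makes `∞` absorbing for sums of bounds; a sum with an empty set would be empty. -/
theorem univ_add_of_nonempty {s : Set ℝ} (hs : s.Nonempty) : Set.univ + s = Set.univ := by
  obtain ⟨x, hx⟩ := hs
  exact Set.eq_univ_of_forall fun r => ⟨r - x, trivial, x, hx, by simp⟩

/-- The sum of two bounds, as used by the Floyd-Warshall algorithm. -/
def Bound.add (b c : Bound P) : Bound P := ⟨b.rel && c.rel, b.expr + c.expr⟩

/-- A sum of two half-lines is closed exactly if both are, which is the conjunction of the relation
symbols. -/
theorem Bound.sols_add (b c : Bound P) : (b.add c).sols v = b.sols v + c.sols v := by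
  induction b using Bound.shapes with
  | top s =>
    rw [Bound.sols_top, univ_add_of_nonempty c.sols_nonempty]
    exact Bound.sols_top _
  | le e =>
    induction c using Bound.shapes with
    | top s =>
      rw [Bound.sols_top, add_comm, univ_add_of_nonempty (Bound.sols_nonempty _)]
      exact Bound.sols_top _
    | le f =>
      rw [Bound.sols_le, Bound.sols_le, Iic_add_Iic, ← Int.cast_add, ← AffExpr.eval_add,
        ← Bound.sols_le]
      rfl
    | lt f =>
      rw [Bound.sols_le, Bound.sols_lt, Iic_add_Iio, ← Int.cast_add, ← AffExpr.eval_add,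
        ← Bound.sols_lt]
      rfl
  | lt e =>
    induction c using Bound.shapes with
    | top s =>
      rw [Bound.sols_top, add_comm, univ_add_of_nonempty (Bound.sols_nonempty _)]
      exact Bound.sols_top _
    | le f =>
      rw [Bound.sols_le, Bound.sols_lt, add_comm, Iic_add_Iio, add_comm, ← Int.cast_add,
        ← AffExpr.eval_add, ← Bound.sols_lt]
      rfl
    | lt f =>
      rw [Bound.sols_lt, Bound.sols_lt, Iio_add_Iio, ← Int.cast_add, ← AffExpr.eval_add,
        ← Bound.sols_lt]
      rfl

/-- Open and closed half-lines with the same end point have the same upper bounds, so the relation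
symbol of `b` plays no role. -/
theorem Bound.sols_subset_Iic (b : Bound P) (z : ℤ) :
    b.sols v ⊆ Set.Iic (z : ℝ) ↔ ExtExpr.eval b.expr v ≤ (z : WithTop ℤ) := by
  induction b using Bound.shapes with
  | top s =>
    rw [Bound.sols_top]
    refine iff_of_false (fun h => ?_) (by simp)
    have := h (Set.mem_univ ((z : ℝ) + 1))
    simp only [Set.mem_Iic] at this
    linarith
  | le e => simp [Bound.sols_le]
  | lt e =>
    rw [Bound.sols_lt]
    simp only [ExtExpr.eval_coe, WithTop.coe_le_coe, Set.Iio_subset_Iic_iff, Int.cast_le]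

theorem Bound.lt_eval (b : Bound P) (z : ℤ) :
    (z : WithTop ℤ) < ExtExpr.eval b.expr v ↔ ∃ r ∈ b.sols v, (z : ℝ) < r := by
  rw [← not_le, ← Bound.sols_subset_Iic, Set.not_subset]
  simp

/-- The constraint that the bound `b` is at least as tight as `b'`. -/
def Bound.tighter (b b' : Bound P) : Constraint P := ⟨b.expr, !b.rel || b'.rel, b'.expr⟩

/-- The comparison is strict only if `b` is closed and `b'` open. The converse fails: for two
infinite bounds with symbols `≤` and `<` the constraint is `∞ < ∞`, although both sets are all of
`ℝ`. -/
theorem Bound.sols_subset_of_tighter {b b' : Bound P} (h : (b.tighter b').Sat v) :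
    b.sols v ⊆ b'.sols v := by
  induction b' using Bound.shapes with
  | top s => rw [Bound.sols_top]; exact Set.subset_univ _
  | le e =>
    rw [Bound.sols_le, Bound.sols_subset_Iic]
    simpa [Bound.tighter, Constraint.Sat, Rel] using h
  | lt e =>
    induction b using Bound.shapes with
    | top s => cases s <;> simp [Bound.tighter, Constraint.Sat, Rel] at h
    | le f =>
      rw [Bound.sols_le, Bound.sols_lt, Set.Iic_subset_Iio]
      simpa [Bound.tighter, Constraint.Sat, Rel] using h
    | lt f =>
      rw [Bound.sols_lt, Bound.sols_lt]
      refine Set.Iio_subset_Iio ?_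
      simpa [Bound.tighter, Constraint.Sat, Rel] using h

/-- The negated constraint implies the constraint with the two bounds exchanged. -/
theorem Bound.sols_subset_of_neg_tighter {b b' : Bound P} (h : (b.tighter b').neg.Sat v) :
    b'.sols v ⊆ b.sols v := by
  apply Bound.sols_subset_of_tighter
  rcases b with ⟨s, e⟩
  rcases b' with ⟨s', e'⟩
  revert h
  cases s <;> cases s' <;> simp +contextual [Bound.tighter, Constraint.neg, Constraint.Sat, Rel, le_of_lt]

/-! ### Application of guards -/

/-- The matrix of the solution sets of the entries under `v`. -/
def CMatrix.slice (Z : CMatrix n P) (v : P → ℤ) (i j : Fin (n + 1)) : Set ℝ := (Z.D i j).sols v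

theorem CMatrix.mem_sem {Z : CMatrix n P} {η : ClockVal n} :
    (v, η) ∈ Z.sem lb ub ↔
      v ∈ semC lb ub Z.C ∧ ∀ i j, (η.1 i : ℝ) - (η.1 j : ℝ) ∈ Z.slice v i j := Iff.rfl

/-- In each branch the constraint decides which of the two half-lines is the smaller one, and that
one is kept. So the kept bound is always the intersection. -/
theorem CMatrix.slice_of_mem_apply {Z Z' : CMatrix n P} {i j : Fin (n + 1)} {b : Bound P}
    (h : Z' ∈ Z.apply lb ub i j b) (hv : v ∈ semC lb ub Z'.C) :
    v ∈ semC lb ub Z.C ∧ ∀ k l, Z'.slice v k l =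
      if k = i ∧ l = j then Z.slice v i j ∩ b.sols v else Z.slice v k l := by
  classical
  have key : ∀ {Z' : CMatrix n P}, Z'.D = Z.D.set i j b → (Z.D i j |>.tighter b).neg.Sat v →
      ∀ k l, Z'.slice v k l =
        if k = i ∧ l = j then Z.slice v i j ∩ b.sols v else Z.slice v k l := by
    intro Z' hD hc k l
    simp only [CMatrix.slice, hD, PMatrix.set]
    split_ifs with hkl
    · exact (Set.inter_eq_right.2 (Bound.sols_subset_of_neg_tighter hc)).symm
    · rfl
  have key' : ∀ {Z' : CMatrix n P}, Z'.D = Z.D → (Z.D i j |>.tighter b).Sat v →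
      ∀ k l, Z'.slice v k l =
        if k = i ∧ l = j then Z.slice v i j ∩ b.sols v else Z.slice v k l := by
    intro Z' hD hc k l
    simp only [CMatrix.slice, hD]
    split_ifs with hkl
    · obtain ⟨rfl, rfl⟩ := hkl
      exact (Set.inter_eq_left.2 (Bound.sols_subset_of_tighter hc)).symm
    · rfl
  unfold CMatrix.apply at h
  change Z' ∈ if Covers lb ub Z.C ((Z.D i j).tighter b).neg then _
    else if Covers lb ub Z.C ((Z.D i j).tighter b) then _ else
      ({⟨insert ((Z.D i j).tighter b) Z.C, Z.D⟩,
        ⟨insert ((Z.D i j).tighter b).neg Z.C, Z.D.set i j b⟩} : Set (CMatrix n P)) at h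
  split_ifs at h with h1 h2
  · cases h
    exact ⟨hv, key rfl (h1 v hv)⟩
  · cases h
    exact ⟨hv, key' rfl (h2 v hv)⟩
  · rcases h with rfl | rfl
    · have := semC_insert.1 (by convert hv)
      exact ⟨this.2, key' rfl this.1⟩
    · have := semC_insert.1 (by convert hv)
      exact ⟨this.2, key rfl this.1⟩

theorem CMatrix.exists_mem_apply {Z : CMatrix n P} (i j : Fin (n + 1)) (b : Bound P)
    (hv : v ∈ semC lb ub Z.C) : ∃ Z' ∈ Z.apply lb ub i j b, v ∈ semC lb ub Z'.C := by
  classical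
  unfold CMatrix.apply
  change ∃ Z' ∈ if Covers lb ub Z.C ((Z.D i j).tighter b).neg then _
    else if Covers lb ub Z.C ((Z.D i j).tighter b) then _ else
      ({⟨insert ((Z.D i j).tighter b) Z.C, Z.D⟩,
        ⟨insert ((Z.D i j).tighter b).neg Z.C, Z.D.set i j b⟩} : Set (CMatrix n P)), _
  split_ifs with h1 h2
  · exact ⟨_, rfl, hv⟩
  · exact ⟨_, rfl, hv⟩
  · by_cases hc : ((Z.D i j).tighter b).Sat v
    · refine ⟨_, Or.inl rfl, ?_⟩
      have := (semC_insert (lb := lb) (ub := ub)).2 ⟨hc, hv⟩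
      convert this
    · refine ⟨_, Or.inr rfl, ?_⟩
      have := (semC_insert (lb := lb) (ub := ub)).2 ⟨(Constraint.neg_sat _).2 hc, hv⟩
      convert this

/-- `Z'` refines `Z` under `v`: its constraints are stronger and its bounds are tighter. -/
def CMatrix.Refines (lb ub v : P → ℤ) (Z' Z : CMatrix n P) : Prop :=
  v ∈ semC lb ub Z'.C → v ∈ semC lb ub Z.C ∧ ∀ i j, Z'.slice v i j ⊆ Z.slice v i j

theorem CMatrix.Refines.refl (Z : CMatrix n P) : Z.Refines lb ub v Z :=
  fun h => ⟨h, fun _ _ => subset_rfl⟩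

theorem CMatrix.Refines.trans {Z Z' Z'' : CMatrix n P} (h : Z''.Refines lb ub v Z')
    (h' : Z'.Refines lb ub v Z) : Z''.Refines lb ub v Z := fun hv =>
  ⟨(h' (h hv).1).1, fun i j => ((h hv).2 i j).trans ((h' (h hv).1).2 i j)⟩

theorem CMatrix.Refines.mem_sem {Z Z' : CMatrix n P} (h : Z'.Refines lb ub v Z) {η : ClockVal n}
    (hη : (v, η) ∈ Z'.sem lb ub) : (v, η) ∈ Z.sem lb ub :=
  ⟨(h hη.1).1, fun i j => (h hη.1).2 i j (hη.2 i j)⟩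

theorem CMatrix.refines_of_mem_apply {Z Z' : CMatrix n P} {i j : Fin (n + 1)} {b : Bound P}
    (h : Z' ∈ Z.apply lb ub i j b) : Z'.Refines lb ub v Z := by
  intro hv
  obtain ⟨h1, h2⟩ := CMatrix.slice_of_mem_apply h hv
  refine ⟨h1, fun k l => ?_⟩
  rw [h2]
  split_ifs with hkl
  · obtain ⟨rfl, rfl⟩ := hkl
    exact Set.inter_subset_left
  · rfl

theorem CMatrix.refines_of_mem_applyGuard {g : SimpleGuard n P} {Z Z' : CMatrix n P}
    (h : Z' ∈ CMatrix.applyGuard lb ub g Z) : Z'.Refines lb ub v Z := by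
  induction g generalizing Z with
  | nil => cases h; exact .refl _
  | cons a g ih =>
    obtain ⟨Z₁, h1, h2⟩ := h
    exact (ih h2).trans (CMatrix.refines_of_mem_apply h1)

theorem SimpleAtom.mem_sols {a : SimpleAtom n P} {η : ClockVal n} :
    (η.1 a.i : ℝ) - (η.1 a.j : ℝ) ∈ (⟨a.rel, (a.expr : WithTop _)⟩ : Bound P).sols v ↔
      a.Sat v η := Iff.rfl

/-- Each conjunct is enforced when it is applied, and later applications only refine. -/
theorem CMatrix.sat_of_mem_applyGuard {g : SimpleGuard n P} {Z Z' : CMatrix n P}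
    (h : Z' ∈ CMatrix.applyGuard lb ub g Z) {η : ClockVal n} (hη : (v, η) ∈ Z'.sem lb ub) :
    g.Sat v η := by
  induction g generalizing Z with
  | nil => simp [SimpleGuard.Sat]
  | cons a g ih =>
    obtain ⟨Z₁, h1, h2⟩ := h
    have h3 := (CMatrix.refines_of_mem_applyGuard h2).mem_sem hη
    intro a' ha'
    rcases List.mem_cons.1 ha' with rfl | ha'
    · have := (CMatrix.mem_sem.1 h3).2 a'.i a'.j
      rw [(CMatrix.slice_of_mem_apply h1 h3.1).2, if_pos ⟨rfl, rfl⟩] at this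
      exact SimpleAtom.mem_sols.1 this.2
    · exact ih h2 a' ha'

theorem CMatrix.exists_mem_applyGuard {g : SimpleGuard n P} {Z : CMatrix n P} {η : ClockVal n}
    (hη : (v, η) ∈ Z.sem lb ub) (hg : g.Sat v η) :
    ∃ Z' ∈ CMatrix.applyGuard lb ub g Z, (v, η) ∈ Z'.sem lb ub := by
  induction g generalizing Z with
  | nil => exact ⟨Z, rfl, hη⟩
  | cons a g ih =>
    obtain ⟨Z₁, h1, hv⟩ := CMatrix.exists_mem_apply a.i a.j ⟨a.rel, (a.expr : WithTop _)⟩ hη.1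
    have h2 : (v, η) ∈ Z₁.sem lb ub := by
      refine CMatrix.mem_sem.2 ⟨hv, fun i j => ?_⟩
      rw [(CMatrix.slice_of_mem_apply h1 hv).2]
      split_ifs with h
      · obtain ⟨rfl, rfl⟩ := h
        exact ⟨hη.2 _ _, SimpleAtom.mem_sols.2 (hg a (by simp))⟩
      · exact hη.2 i j
    obtain ⟨Z', h3, h4⟩ := ih h2 (fun a' ha' => hg a' (by simp [ha']))
    exact ⟨Z', ⟨Z₁, h1, h3⟩, h4⟩

end ParTimed

namespace ParTimed

open scoped Pointwise

variable {P : Type*} [Fintype P] {n : ℕ} {lb ub v : P → ℤ}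

/-! ### The canonical set -/

/-- A matrix of sets of reals that is closed under composition of bounds. -/
def Triangle {ι : Type*} (S : ι → ι → Set ℝ) : Prop := ∀ i k j, S i j ⊆ S i k + S k j

theorem CMatrix.slice_add (Z : CMatrix n P) (i k j : Fin (n + 1)) :
    (⟨(Z.D i k).rel && (Z.D k j).rel, (Z.D i k).expr + (Z.D k j).expr⟩ : Bound P).sols v =
      Z.slice v i k + Z.slice v k j :=
  Bound.sols_add (Z.D i k) (Z.D k j)

theorem CMatrix.isLowerSet_slice (Z : CMatrix n P) (i j : Fin (n + 1)) :
    IsLowerSet (Z.slice v i j) := (Z.D i j).isLowerSet_sols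

theorem CMatrix.slice_nonempty (Z : CMatrix n P) (i j : Fin (n + 1)) :
    (Z.slice v i j).Nonempty := (Z.D i j).sols_nonempty

theorem FWStep.refines {c c' : ℕ × ℕ × ℕ × CMatrix n P} (h : FWStep lb ub c c') :
    c'.2.2.2.Refines lb ub v c.2.2.2 := by
  cases h with
  | relax k i j Z Z' h => exact CMatrix.refines_of_mem_apply h
  | nextRow => exact .refl _
  | nextPivot => exact .refl _

theorem FWStep.refines_of_reflTransGen {c c' : ℕ × ℕ × ℕ × CMatrix n P}
    (h : Relation.ReflTransGen (FWStep lb ub) c c') : c'.2.2.2.Refines lb ub v c.2.2.2 := by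
  induction h with
  | refl => exact .refl _
  | tail _ h ih => exact h.refines.trans ih

theorem CMatrix.refines_of_mem_canon {Z Z' : CMatrix n P} (h : Z' ∈ Z.canon lb ub) :
    Z'.Refines lb ub v Z :=
  FWStep.refines_of_reflTransGen (c := (0, 0, 0, Z)) (c' := (n + 1, 0, 0, Z')) h

/-- A relaxed bound is implied by the two bounds it is composed of, so clock valuations are never
lost; only the added constraints can exclude `v`. -/
theorem FWStep.mem_sem {c c' : ℕ × ℕ × ℕ × CMatrix n P} (h : FWStep lb ub c c') {η : ClockVal n}
    (hη : (v, η) ∈ c.2.2.2.sem lb ub) (hv : v ∈ semC lb ub c'.2.2.2.C) :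
    (v, η) ∈ c'.2.2.2.sem lb ub := by
  cases h with
  | relax k i j Z Z' h =>
    refine CMatrix.mem_sem.2 ⟨hv, fun a b => ?_⟩
    rw [(CMatrix.slice_of_mem_apply h hv).2, CMatrix.slice_add]
    split_ifs with hab
    · obtain ⟨rfl, rfl⟩ := hab
      exact ⟨hη.2 _ _, Set.mem_add.2 ⟨_, hη.2 a k, _, hη.2 k b, by ring⟩⟩
    · exact hη.2 a b
  | nextRow => exact hη
  | nextPivot => exact hη

theorem CMatrix.mem_sem_of_mem_canon {Z Z' : CMatrix n P} (h : Z' ∈ Z.canon lb ub)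
    {η : ClockVal n} (hη : (v, η) ∈ Z.sem lb ub) (hv : v ∈ semC lb ub Z'.C) :
    (v, η) ∈ Z'.sem lb ub := by
  have key : ∀ {c : ℕ × ℕ × ℕ × CMatrix n P},
      Relation.ReflTransGen (FWStep lb ub) (0, 0, 0, Z) c →
      v ∈ semC lb ub c.2.2.2.C → (v, η) ∈ c.2.2.2.sem lb ub := by
    intro c h
    induction h with
    | refl => exact fun _ => hη
    | tail _ h ih => exact fun hv => h.mem_sem (ih (h.refines hv).1) hv
  exact key (c := (n + 1, 0, 0, Z')) h hv

/-- At every relaxation some branch retains `v`; this and the next two results follow such branches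
through the three loops. -/
theorem FWStep.exists_row (k i : Fin (n + 1)) (Z : CMatrix n P) (hv : v ∈ semC lb ub Z.C)
    (j : ℕ) (hj : j ≤ n + 1) : ∃ Z' : CMatrix n P, v ∈ semC lb ub Z'.C ∧
      Relation.ReflTransGen (FWStep lb ub) ((k : ℕ), (i : ℕ), 0, Z) ((k : ℕ), (i : ℕ), j, Z') := by
  induction j with
  | zero => exact ⟨Z, hv, .refl⟩
  | succ j ih =>
    obtain ⟨Z₁, h1, h2⟩ := ih (by omega)
    obtain ⟨Z₂, h3, h4⟩ := CMatrix.exists_mem_apply i ⟨j, by omega⟩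
      ⟨(Z₁.D i k).rel && (Z₁.D k ⟨j, by omega⟩).rel,
        (Z₁.D i k).expr + (Z₁.D k ⟨j, by omega⟩).expr⟩ h1
    exact ⟨Z₂, h4, h2.tail (FWStep.relax k i ⟨j, by omega⟩ Z₁ Z₂ h3)⟩

theorem FWStep.exists_pivot (k : Fin (n + 1)) (Z : CMatrix n P) (hv : v ∈ semC lb ub Z.C)
    (i : ℕ) (hi : i ≤ n + 1) : ∃ Z' : CMatrix n P, v ∈ semC lb ub Z'.C ∧
      Relation.ReflTransGen (FWStep lb ub) ((k : ℕ), 0, 0, Z) ((k : ℕ), i, 0, Z') := by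
  induction i with
  | zero => exact ⟨Z, hv, .refl⟩
  | succ i ih =>
    obtain ⟨Z₁, h1, h2⟩ := ih (by omega)
    obtain ⟨Z₂, h3, h4⟩ := FWStep.exists_row k ⟨i, by omega⟩ Z₁ h1 (n + 1) le_rfl
    exact ⟨Z₂, h3, (h2.trans h4).tail (FWStep.nextRow k ⟨i, by omega⟩ Z₂)⟩

theorem CMatrix.exists_mem_canon {Z : CMatrix n P} (hv : v ∈ semC lb ub Z.C) :
    ∃ Z' ∈ Z.canon lb ub, v ∈ semC lb ub Z'.C := by
  have key : ∀ k ≤ n + 1, ∃ Z' : CMatrix n P, v ∈ semC lb ub Z'.C ∧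
      Relation.ReflTransGen (FWStep lb ub) (0, 0, 0, Z) (k, 0, 0, Z') := by
    intro k hk
    induction k with
    | zero => exact ⟨Z, hv, .refl⟩
    | succ k ih =>
      obtain ⟨Z₁, h1, h2⟩ := ih (by omega)
      obtain ⟨Z₂, h3, h4⟩ := FWStep.exists_pivot ⟨k, by omega⟩ Z₁ h1 (n + 1) le_rfl
      exact ⟨Z₂, h3, (h2.trans h4).tail (FWStep.nextPivot ⟨k, by omega⟩ Z₂)⟩
  obtain ⟨Z', h1, h2⟩ := key (n + 1) le_rfl
  exact ⟨Z', h2, h1⟩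

/-- The matrix is closed under compositions at the pivots below `k`. -/
def TriangleBelow (k : ℕ) (S : Fin (n + 1) → Fin (n + 1) → Set ℝ) : Prop :=
  ∀ i (p : Fin (n + 1)) j, (p : ℕ) < k → S i j ⊆ S i p + S p j

/-- Applied with `B` a diagonal entry: relaxing the column of the pivot changes nothing. The mirror
image below serves for the row. -/
theorem subset_add_of_zero_mem_right {A B : Set ℝ} (h : (0 : ℝ) ∈ B) : A ⊆ A + B :=
  fun a ha => Set.mem_add.2 ⟨a, ha, 0, h, add_zero a⟩

theorem subset_add_of_zero_mem_left {A B : Set ℝ} (h : (0 : ℝ) ∈ A) : B ⊆ A + B :=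
  fun a ha => Set.mem_add.2 ⟨0, h, a, ha, zero_add a⟩

/-- One full round of the Floyd-Warshall algorithm adds a pivot. -/
theorem TriangleBelow.pivot {S S' : Fin (n + 1) → Fin (n + 1) → Set ℝ} {k : Fin (n + 1)}
    (hS : TriangleBelow k S) (hlow : ∀ i j, IsLowerSet (S i j)) (hk : (0 : ℝ) ∈ S k k)
    (hS' : ∀ i j, S' i j = S i j ∩ (S i k + S k j)) : TriangleBelow (k + 1) S' := by
  have hlow' : ∀ i j, IsLowerSet (S i k + S k j) := by
    rintro i j a b hba ⟨x, hx, y, hy, rfl⟩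
    exact ⟨x, hx, b - x, hlow k j (by linarith) hy, by simp⟩
  have hcol : ∀ i, S' i k = S i k := fun i => by
    rw [hS', Set.inter_eq_left]; exact subset_add_of_zero_mem_right hk
  have hrow : ∀ j, S' k j = S k j := fun j => by
    rw [hS', Set.inter_eq_left]; exact subset_add_of_zero_mem_left hk
  intro i p j hp
  rcases Nat.lt_succ_iff_lt_or_eq.1 hp with hp | hp
  · have h1 : S' i p = S i p ∨ S' i p = S i k + S k p := by
      rw [hS', Set.inter_eq_left, Set.inter_eq_right]
      exact (hlow i p).total (hlow' i p)
    have h2 : S' p j = S p j ∨ S' p j = S p k + S k j := by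
      rw [hS', Set.inter_eq_left, Set.inter_eq_right]
      exact (hlow p j).total (hlow' p j)
    have hi := hS i p k hp
    have hj := hS k p j hp
    have hij : S' i j ⊆ S i k + S k j := by rw [hS']; exact Set.inter_subset_right
    rcases h1 with h1 | h1 <;> rcases h2 with h2 | h2 <;> rw [h1, h2]
    · rw [hS']; exact Set.inter_subset_left.trans (hS i p j hp)
    · rw [← add_assoc]
      exact hij.trans (Set.add_subset_add_right hi)
    · rw [add_assoc]
      exact hij.trans (Set.add_subset_add_left hj)
    -- Both factors pass through `k`. The detour from `k` to `p` and back costs nothing, since `0 ∈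
    -- S k k ⊆ S k p + S p k`.
    · refine hij.trans ?_
      rw [add_assoc]
      refine Set.add_subset_add_left ?_
      rw [← add_assoc]
      refine (subset_add_of_zero_mem_left hk).trans (Set.add_subset_add_right (hS k p k hp))
  · have hpk : p = k := Fin.ext hp
    subst hpk
    rw [hcol, hrow, hS']
    exact Set.inter_subset_right

/-- The invariant of the Floyd-Warshall algorithm: the current matrix arises from one that is
closed under compositions at the preceding pivots by relaxing the entries visited so far. -/
def FWInvariant (v : P → ℤ) (c : ℕ × ℕ × ℕ × CMatrix n P) : Prop :=
  ∃ S : Fin (n + 1) → Fin (n + 1) → Set ℝ, TriangleBelow c.1 S ∧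
    (∀ i j, IsLowerSet (S i j)) ∧ (∀ i, (0 : ℝ) ∈ S i i) ∧
    ∀ a b : Fin (n + 1),
      (¬ ((a : ℕ) < c.2.1 ∨ (a : ℕ) = c.2.1 ∧ (b : ℕ) < c.2.2.1) → c.2.2.2.slice v a b = S a b) ∧
      (((a : ℕ) < c.2.1 ∨ (a : ℕ) = c.2.1 ∧ (b : ℕ) < c.2.2.1) →
        ∀ p : Fin (n + 1), (p : ℕ) = c.1 → c.2.2.2.slice v a b = S a b ∩ (S a p + S p b))

/-- The algorithm updates in place, but what a relaxation reads besides its own entry lies in the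
row and column of the pivot. These do not change during a round because `0` lies on the diagonal. So
every entry is relaxed with the values from the start of the round. -/
theorem FWInvariant.step {c c' : ℕ × ℕ × ℕ × CMatrix n P} (hc : FWInvariant v c)
    (h : FWStep lb ub c c') (hv : v ∈ semC lb ub c'.2.2.2.C)
    (h0 : ∀ i, (0 : ℝ) ∈ c'.2.2.2.slice v i i) : FWInvariant v c' := by
  obtain ⟨S, hT, hlow, hdiag, hS⟩ := hc
  cases h with
  | relax k i j Z Z' h =>
    refine ⟨S, hT, hlow, hdiag, fun a b => ?_⟩
    simp only at hS ⊢
    rw [(CMatrix.slice_of_mem_apply h hv).2, CMatrix.slice_add]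
    have hcol : Z.slice v i k = S i k := by
      by_cases hp : (i : ℕ) < i ∨ (i : ℕ) = i ∧ (k : ℕ) < j
      · rw [(hS i k).2 hp k rfl, Set.inter_eq_left]
        exact subset_add_of_zero_mem_right (hdiag k)
      · exact (hS i k).1 hp
    have hrow : Z.slice v k j = S k j := by
      by_cases hp : (k : ℕ) < i ∨ (k : ℕ) = i ∧ (j : ℕ) < j
      · rw [(hS k j).2 hp k rfl, Set.inter_eq_left]
        exact subset_add_of_zero_mem_left (hdiag k)
      · exact (hS k j).1 hp
    have hent : Z.slice v i j = S i j := (hS i j).1 (by omega)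
    rw [hcol, hrow, hent]
    by_cases hab : a = i ∧ b = j
    · obtain ⟨rfl, rfl⟩ := hab
      refine ⟨fun hn => absurd (Or.inr ⟨rfl, Nat.lt_succ_self _⟩) hn, fun _ p hp => ?_⟩
      rw [Fin.ext hp]
      simp
    · rw [if_neg hab]
      have hiff : ((a : ℕ) < i ∨ (a : ℕ) = i ∧ (b : ℕ) < j + 1) ↔
          ((a : ℕ) < i ∨ (a : ℕ) = i ∧ (b : ℕ) < j) := by
        rw [Fin.ext_iff, Fin.ext_iff] at hab
        omega
      rw [hiff]
      exact hS a b
  | nextRow k i Z =>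
    refine ⟨S, hT, hlow, hdiag, fun a b => ?_⟩
    simp only at hS ⊢
    have hiff : ((a : ℕ) < i + 1 ∨ (a : ℕ) = i + 1 ∧ (b : ℕ) < 0) ↔
        ((a : ℕ) < i ∨ (a : ℕ) = i ∧ (b : ℕ) < n + 1) := by
      have := b.2
      omega
    rw [hiff]
    exact hS a b
  | nextPivot k Z =>
    -- All entries have been relaxed, so the current matrix becomes the reference matrix of the next
    -- round.
    refine ⟨Z.slice v, ?_, Z.isLowerSet_slice, h0, fun a b => ⟨fun _ => rfl, fun h => ?_⟩⟩
    · exact hT.pivot hlow (hdiag k) fun a b => (hS a b).2 (Or.inl a.2) k rfl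
    · simp at h

/-- Under a valuation for which no diagonal entry has become negative, the members of the canonical
set are closed under composition. -/
theorem CMatrix.triangle_of_mem_canon {Z Z' : CMatrix n P} (h : Z' ∈ Z.canon lb ub)
    (hv : v ∈ semC lb ub Z'.C) (h0 : ∀ i, (0 : ℝ) ∈ Z'.slice v i i) : Triangle (Z'.slice v) := by
  have key : ∀ {c : ℕ × ℕ × ℕ × CMatrix n P},
      Relation.ReflTransGen (FWStep lb ub) (0, 0, 0, Z) c →
      v ∈ semC lb ub c.2.2.2.C → (∀ i, (0 : ℝ) ∈ c.2.2.2.slice v i i) → FWInvariant v c := by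
    intro c h
    induction h with
    | refl =>
      refine fun _ h0 => ⟨Z.slice v, fun _ _ _ h => absurd h (Nat.not_lt_zero _),
        Z.isLowerSet_slice, h0, fun a b => ⟨fun _ => rfl, fun h => ?_⟩⟩
      simp at h
    | tail _ h ih =>
      intro hv h0
      -- Bounds only shrink, so a diagonal that contains `0` at the end contained it at all earlier
      -- stages.
      obtain ⟨h1, h2⟩ := h.refines hv
      exact (ih h1 fun i => h2 i i (h0 i)).step h hv h0
  obtain ⟨S, hT, -, -, hS⟩ := key (c := (n + 1, 0, 0, Z')) h hv h0
  have hS' : Z'.slice v = S := by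
    funext a b
    exact (hS a b).1 (by simp)
  rw [hS']
  exact fun i k j => hT i k j k.2

end ParTimed

namespace ParTimed

open scoped Pointwise

/-! ### Extension of partial solutions -/

/-- Helly's theorem on the line, for finitely many lower and finitely many upper sets. -/
theorem exists_mem_of_lower_upper {α β : Type*} (F : Finset α) (G : Finset β) (f : α → Set ℝ)
    (g : β → Set ℝ) (hf : ∀ a ∈ F, IsLowerSet (f a)) (hg : ∀ b ∈ G, IsUpperSet (g b))
    (hfn : ∀ a ∈ F, (f a).Nonempty) (hgn : ∀ b ∈ G, (g b).Nonempty)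
    (h : ∀ a ∈ F, ∀ b ∈ G, (f a ∩ g b).Nonempty) :
    ∃ t, (∀ a ∈ F, t ∈ f a) ∧ ∀ b ∈ G, t ∈ g b := by
  -- A finite nonempty chain has a least member, so the claim reduces to one lower and one upper
  -- set.
  have hF : F.Nonempty → ∃ a ∈ F, ∀ a' ∈ F, f a ⊆ f a' := by
    intro hne
    clear h hfn
    induction hne using Finset.Nonempty.cons_induction with
    | singleton a => exact ⟨a, by simp⟩
    | cons a s ha hs ih =>
      obtain ⟨b, hb, hb'⟩ := ih fun x hx => hf x (Finset.mem_cons_of_mem hx)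
      rcases (hf a (Finset.mem_cons_self a s)).total (hf b (Finset.mem_cons_of_mem hb)) with h | h
      · exact ⟨a, Finset.mem_cons_self a s, (Finset.forall_mem_cons ha _).2
          ⟨subset_rfl, fun x hx => h.trans (hb' x hx)⟩⟩
      · exact ⟨b, Finset.mem_cons_of_mem hb, (Finset.forall_mem_cons ha _).2 ⟨h, hb'⟩⟩
  have hG : G.Nonempty → ∃ a ∈ G, ∀ a' ∈ G, g a ⊆ g a' := by
    intro hne
    clear h hgn
    induction hne using Finset.Nonempty.cons_induction with
    | singleton a => exact ⟨a, by simp⟩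
    | cons a s ha hs ih =>
      obtain ⟨b, hb, hb'⟩ := ih fun x hx => hg x (Finset.mem_cons_of_mem hx)
      rcases (hg a (Finset.mem_cons_self a s)).total (hg b (Finset.mem_cons_of_mem hb)) with h | h
      · exact ⟨a, Finset.mem_cons_self a s, (Finset.forall_mem_cons ha _).2
          ⟨subset_rfl, fun x hx => h.trans (hb' x hx)⟩⟩
      · exact ⟨b, Finset.mem_cons_of_mem hb, (Finset.forall_mem_cons ha _).2 ⟨h, hb'⟩⟩
  rcases F.eq_empty_or_nonempty with rfl | hFn
  · rcases G.eq_empty_or_nonempty with rfl | hGn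
    · exact ⟨0, by simp, by simp⟩
    · obtain ⟨b, hb, hb'⟩ := hG hGn
      obtain ⟨t, ht⟩ := hgn b hb
      exact ⟨t, by simp, fun b' h' => hb' b' h' ht⟩
  · obtain ⟨a, ha, ha'⟩ := hF hFn
    rcases G.eq_empty_or_nonempty with rfl | hGn
    · obtain ⟨t, ht⟩ := hfn a ha
      exact ⟨t, fun b' h' => ha' b' h' ht, by simp⟩
    · obtain ⟨b, hb, hb'⟩ := hG hGn
      obtain ⟨t, ht, ht'⟩ := h a ha b hb
      exact ⟨t, fun x hx => ha' x hx ht, fun x hx => hb' x hx ht'⟩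

/-- Solutions of a system of difference constraints that is closed under composition can be
extended point by point. The rows `T u` bound the differences between fixed reals `c u`
and the points. -/
theorem Triangle.exists_extension {ι κ : Type*} [Fintype ι] [Fintype κ] {S : ι → ι → Set ℝ}
    {T : κ → ι → Set ℝ} {c : κ → ℝ} (hS : Triangle S) (hlow : ∀ i j, IsLowerSet (S i j))
    (hne : ∀ i j, (S i j).Nonempty) (h0 : ∀ i, (0 : ℝ) ∈ S i i)
    (hT : ∀ u k j, T u j ⊆ T u k + S k j) (hTlow : ∀ u j, IsLowerSet (T u j))
    (hTne : ∀ u j, (T u j).Nonempty)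
    (X : Set ι) (p : ι → ℝ) (hX : ∀ i ∈ X, ∀ j ∈ X, p i - p j ∈ S i j)
    (hTX : ∀ u, ∀ j ∈ X, c u - p j ∈ T u j) :
    ∃ q : ι → ℝ, (∀ i ∈ X, q i = p i) ∧ (∀ i j, q i - q j ∈ S i j) ∧
      ∀ u j, c u - q j ∈ T u j := by
  classical
  have key : ∀ Y : Finset ι, ∃ q : ι → ℝ, (∀ i ∈ X, q i = p i) ∧
      (∀ i j, i ∈ X ∪ Y → j ∈ X ∪ Y → q i - q j ∈ S i j) ∧
      ∀ u, ∀ j ∈ X ∪ Y, c u - q j ∈ T u j := by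
    intro Y
    induction Y using Finset.induction_on with
    | empty => exact ⟨p, fun _ _ => rfl, by simpa using fun i j hi hj => hX i hi j hj, by simpa using hTX⟩
    | insert z Y hz ih =>
      obtain ⟨q, hq, hqS, hqT⟩ := ih
      by_cases hzX : z ∈ X
      · have : X ∪ ↑(insert z Y) = X ∪ (Y : Set ι) := by
          ext i; simp only [Finset.coe_insert, Set.mem_union, Set.mem_insert_iff]
          constructor
          · rintro (h | rfl | h)
            exacts [Or.inl h, Or.inl hzX, Or.inr h]
          · tauto
        rw [this]
        exact ⟨q, hq, hqS, hqT⟩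
      · let F : Finset ι := {i | i ∈ X ∪ (Y : Set ι)}
        have hF : ∀ i, i ∈ F ↔ i ∈ X ∪ (Y : Set ι) := fun i => by simp [F]
        -- The value `t` at the new point `z` is bounded above by the row of `z`, and below by its
        -- column and by the rows `T u`. Closure under composition through `z` makes any upper and
        -- lower bound compatible.
        obtain ⟨t, ht, ht'⟩ := exists_mem_of_lower_upper F
          (F.disjSum (Finset.univ : Finset κ)) (fun i => {t | t - q i ∈ S z i})
          (Sum.elim (fun i => {t | q i - t ∈ S i z}) (fun u => {t | c u - t ∈ T u z}))
          (fun i _ a b hba ha => hlow z i (by linarith) ha)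
          (by
            rintro (i | u) - a b hab ha
            · exact hlow i z (by linarith) ha
            · exact hTlow u z (by linarith) ha)
          (fun i _ => by
            obtain ⟨x, hx⟩ := hne z i
            exact ⟨x + q i, by simpa using hx⟩)
          (by
            rintro (i | u) -
            · obtain ⟨x, hx⟩ := hne i z
              exact ⟨q i - x, by simpa using hx⟩
            · obtain ⟨x, hx⟩ := hTne u z
              exact ⟨c u - x, by simpa using hx⟩)
          (by
            rintro i hi (j | u) hj
            · obtain ⟨x, hx, y, hy, hxy⟩ := Set.mem_add.1
                (hS j z i (hqS j i ((hF j).1 (by simpa using hj)) ((hF i).1 hi)))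
              refine ⟨q i + y, ?_, ?_⟩
              · simpa using hy
              · have : q j - (q i + y) = x := by linarith
                simpa [this] using hx
            · obtain ⟨x, hx, y, hy, hxy⟩ := Set.mem_add.1 (hT u z i (hqT u i ((hF i).1 hi)))
              refine ⟨q i + y, ?_, ?_⟩
              · simpa using hy
              · have : c u - (q i + y) = x := by linarith
                simpa [this] using hx)
        have hzF : ∀ i ∈ F, i ≠ z := by
          rintro i hi rfl
          rcases (hF i).1 hi with h | h
          exacts [hzX h, hz h]
        have hmem : ∀ i, i ∈ X ∪ ((insert z Y : Finset ι) : Set ι) → i = z ∨ i ∈ F := by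
          intro i hi
          rw [hF]
          simp only [Finset.coe_insert, Set.mem_union, Set.mem_insert_iff] at hi ⊢
          tauto
        clear_value F
        refine ⟨Function.update q z t, fun i hi => ?_, fun i j hi hj => ?_, fun u j hj => ?_⟩
        · rw [Function.update_of_ne (by rintro rfl; exact hzX hi), hq i hi]
        · rcases hmem i hi with rfl | hi' <;> rcases hmem j hj with rfl | hj'
          · simpa using h0 _
          · rw [Function.update_self, Function.update_of_ne (hzF j hj')]
            exact ht j hj'
          · rw [Function.update_self, Function.update_of_ne (hzF i hi')]
            exact ht' (Sum.inl i) (by simpa using hi')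
          · rw [Function.update_of_ne (hzF i hi'), Function.update_of_ne (hzF j hj')]
            exact hqS i j ((hF i).1 hi') ((hF j).1 hj')
        · rcases hmem j hj with rfl | hj
          · rw [Function.update_self]
            exact ht' (Sum.inr u) (by simp)
          · rw [Function.update_of_ne (hzF j hj)]
            exact hqT u j ((hF j).1 hj)
  obtain ⟨q, h1, h2, h3⟩ := key Finset.univ
  exact ⟨q, h1, fun i j => h2 i j (by simp) (by simp), fun u j => h3 u j (by simp)⟩

/-! ### Integer bounds on differences -/

/-- The reals that satisfy all integer upper bounds that `x` satisfies. -/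
def intHull (x : ℝ) : Set ℝ := {r | ∀ c : ℤ, (x ≤ c → r ≤ c) ∧ (x < c → r < c)}

theorem isLowerSet_intHull (x : ℝ) : IsLowerSet (intHull x) := fun _ _ hba ha c =>
  ⟨fun h => hba.trans ((ha c).1 h), fun h => hba.trans_lt ((ha c).2 h)⟩

theorem self_mem_intHull (x : ℝ) : x ∈ intHull x := fun _ => ⟨id, id⟩

theorem mem_intHull_of_lt_ceil {x r : ℝ} (h : r < ⌈x⌉) : r ∈ intHull x := fun c =>
  ⟨fun hc => h.le.trans (by exact_mod_cast Int.ceil_le.2 hc),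
    fun hc => h.trans_le (by exact_mod_cast Int.ceil_le.2 hc.le)⟩

/-- `intHull x` is `Iic x` if `x` is an integer and `Iio ⌈x⌉` otherwise. An integer summand acts as
a translation. If neither summand is an integer, then `x + y < ⌈x⌉ + ⌈y⌉`, and the slack of `r`
below this sum is split evenly. Consequently the hulls of all differences of a family of reals are
closed under composition. -/
theorem intHull_add_subset (x y : ℝ) : intHull (x + y) ⊆ intHull x + intHull y := by
  intro r hr
  rcases le_or_gt r (x + y) with h | h
  · exact Set.mem_add.2 ⟨x, self_mem_intHull x, r - x,
      isLowerSet_intHull y (by linarith) (self_mem_intHull y), by ring⟩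
  · have hx := Int.le_ceil x
    have hy := Int.le_ceil y
    rcases hx.eq_or_lt with hx | hx
    · refine Set.mem_add.2 ⟨x, self_mem_intHull x, r - x, fun c => ?_, by ring⟩
      have := hr (⌈x⌉ + c)
      push_cast at this
      rw [← hx] at this
      exact ⟨fun hc => by linarith [this.1 (by linarith)],
        fun hc => by linarith [this.2 (by linarith)]⟩
    · rcases hy.eq_or_lt with hy | hy
      · refine Set.mem_add.2 ⟨r - y, fun c => ?_, y, self_mem_intHull y, by ring⟩
        have := hr (⌈y⌉ + c)
        push_cast at this
        rw [← hy] at this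
        exact ⟨fun hc => by linarith [this.1 (by linarith)],
          fun hc => by linarith [this.2 (by linarith)]⟩
      · have := (hr (⌈x⌉ + ⌈y⌉)).2 (by push_cast; linarith)
        push_cast at this
        refine Set.mem_add.2 ⟨⌈x⌉ - (⌈x⌉ + ⌈y⌉ - r) / 2, mem_intHull_of_lt_ceil (by linarith),
          ⌈y⌉ - (⌈x⌉ + ⌈y⌉ - r) / 2, mem_intHull_of_lt_ceil (by linarith), by ring⟩

/-- The ceiling decides the bounds `≤ c`, the floor the bounds `< c`. -/
theorem mem_intHull_of_ceil {x y : ℝ} (hc : ⌈x⌉ = ⌈y⌉) (hf : ⌊x⌋ = ⌊y⌋) : y ∈ intHull x := by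
  refine fun c => ⟨fun h => ?_, fun h => ?_⟩
  · rw [← Int.ceil_le] at h ⊢
    rwa [← hc]
  · rw [← Int.floor_lt] at h ⊢
    rwa [← hf]

/-! ### The region relation -/

variable {n : ℕ} {M : Fin (n + 1) → ℤ}

/-- `η'` satisfies the integer bounds that `η` satisfies on the clocks that do not exceed `M` and on
their differences. -/
def RegionLE (M : Fin (n + 1) → ℤ) (η η' : ClockVal n) : Prop :=
  ∃ X : Set (Fin (n + 1)), 0 ∈ X ∧ (∀ x ∉ X, (M x : ℝ) < η.1 x ∧ (M x : ℝ) < η'.1 x) ∧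
    ∀ x ∈ X, ∀ y ∈ X, (η'.1 x : ℝ) - η'.1 y ∈ intHull ((η.1 x : ℝ) - η.1 y)

/-- The negation of `x - y ≤ c` is `y - x < -c`, again an integer upper bound on a difference. So
preservation for all ordered pairs is also reflection. -/
theorem RegionLE.symm {η η' : ClockVal n} (h : RegionLE M η η') : RegionLE M η' η := by
  obtain ⟨X, h0, hl, hs⟩ := h
  refine ⟨X, h0, fun x hx => (hl x hx).symm, fun x hx y hy c => ⟨fun hc => ?_, fun hc => ?_⟩⟩
  · by_contra! hlt
    have := (hs y hy x hx (-c)).2 (by push_cast; linarith)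
    push_cast at this
    linarith
  · by_contra! hle
    have := (hs y hy x hx (-c)).1 (by push_cast; linarith)
    push_cast at this
    linarith

theorem ClockVal.coe_zero (η : ClockVal n) : (η.1 0 : ℝ) = 0 := by simp [η.2]

theorem ClockVal.coe_delay (η : ClockVal n) (d : ℝ≥0) {x : Fin (n + 1)} (hx : x ≠ 0) :
    ((η.delay d).1 x : ℝ) = η.1 x + d := by
  simp [ClockVal.delay, hx]

theorem ClockVal.coe_reset (η : ClockVal n) (R : Finset (Fin (n + 1))) (x : Fin (n + 1)) :
    ((η.reset R).1 x : ℝ) = η.1 (if x ∈ R then 0 else x) := by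
  simp only [ClockVal.reset]
  split_ifs <;> simp [η.2]

theorem RegionLE.reset {η η' : ClockVal n} (h : RegionLE M η η') (R : Finset (Fin (n + 1))) :
    RegionLE M (η.reset R) (η'.reset R) := by
  obtain ⟨X, h0, hl, hs⟩ := h
  -- Reset clocks behave like `x_0`, so they join `X` whatever their former values.
  refine ⟨X ∪ R, Or.inl h0, fun x hx => ?_, fun x hx y hy => ?_⟩
  · rw [Set.mem_union, not_or] at hx
    have hxR : x ∉ R := hx.2
    rw [ClockVal.coe_reset, ClockVal.coe_reset, if_neg hxR]
    exact hl x hx.1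
  · have key : ∀ z ∈ X ∪ (R : Set (Fin (n + 1))), (if z ∈ R then 0 else z) ∈ X := by
      intro z hz
      split_ifs with h
      · exact h0
      · exact hz.resolve_right h
    simp only [ClockVal.coe_reset]
    exact hs _ (key x hx) _ (key y hy)

/-- The number `-d` is treated as one more point: its distance to a clock is the value of that clock
after the delay. The given values of `η'` on `X` solve the closed system of integer hulls, and
extending them to the new point yields `-d'`. -/
theorem RegionLE.delay {η η' : ClockVal n} (h : RegionLE M η η') (d : ℝ≥0) :
    ∃ d', RegionLE M (η.delay d) (η'.delay d') := by
  obtain ⟨X, h0, hl, hs⟩ := h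
  let p : Option (Fin (n + 1)) → ℝ := fun o => o.elim (-(d : ℝ)) fun x => η.1 x
  let p' : Option (Fin (n + 1)) → ℝ := fun o => o.elim 0 fun x => η'.1 x
  obtain ⟨q, hq, hqS, -⟩ := Triangle.exists_extension (κ := Empty)
    (S := fun i j => intHull (p i - p j)) (T := fun u => u.elim) (c := fun u => u.elim)
    (fun i k j => by simpa using intHull_add_subset (p i - p k) (p k - p j))
    (fun _ _ => isLowerSet_intHull _) (fun _ _ => ⟨_, self_mem_intHull _⟩)
    (fun i => by simpa using self_mem_intHull (p i - p i)) (fun u => u.elim) (fun u => u.elim)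
    (fun u => u.elim) (some '' X) p'
    (by rintro _ ⟨x, hx, rfl⟩ _ ⟨y, hy, rfl⟩; exact hs x hx y hy) (fun u => u.elim)
  have hq0 : q (some 0) = 0 := by rw [hq _ ⟨0, h0, rfl⟩]; exact η'.coe_zero
  -- The integer bound `-d - 0 ≤ 0` carries over to the new point.
  have hd : 0 ≤ -q none := by
    have := (hqS none (some 0) 0).1 (by simp [p, η.2])
    rw [hq0] at this
    simpa using this
  have hval : ∀ x ∈ X, q (some x) = η'.1 x := fun x hx => hq _ ⟨x, hx, rfl⟩
  obtain ⟨d', hd'⟩ : ∃ d' : ℝ≥0, (d' : ℝ) = -q none := ⟨⟨_, hd⟩, rfl⟩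
  refine ⟨d', X, h0, fun x hx => ?_, fun x hx y hy => ?_⟩
  · have hx0 : x ≠ 0 := by rintro rfl; exact hx h0
    rw [ClockVal.coe_delay _ _ hx0, ClockVal.coe_delay _ _ hx0]
    have h1 := (hl x hx).1
    have h2 := (hl x hx).2
    have h3 : (0 : ℝ) ≤ d := d.2
    refine ⟨by linarith, ?_⟩
    linarith
  · have hcong : ∀ {a b r s : ℝ}, r ∈ intHull a → s = r → b = a → s ∈ intHull b := by
      rintro a b r s h rfl rfl; exact h
    by_cases hx0 : x = 0 <;> by_cases hy0 : y = 0
    · subst hx0 hy0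
      simpa using self_mem_intHull 0
    · subst hx0
      rw [ClockVal.coe_delay _ _ hy0, ClockVal.coe_delay _ _ hy0, ClockVal.coe_zero,
        ClockVal.coe_zero]
      have := hqS none (some y)
      rw [hval y hy] at this
      simp only [p, Option.elim] at this
      rw [hd']
      exact hcong this (by ring) (by ring)
    · subst hy0
      rw [ClockVal.coe_delay _ _ hx0, ClockVal.coe_delay _ _ hx0, ClockVal.coe_zero,
        ClockVal.coe_zero]
      have := hqS (some x) none
      rw [hval x hx] at this
      simp only [p, Option.elim] at this
      rw [hd']
      exact hcong this (by ring) (by ring)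
    · rw [ClockVal.coe_delay _ _ hx0, ClockVal.coe_delay _ _ hx0, ClockVal.coe_delay _ _ hy0,
        ClockVal.coe_delay _ _ hy0]
      simpa using hs x hx y hy

theorem RegionLE.of_eq_or_lt {η η' : ClockVal n}
    (h : ∀ x, η.1 x = η'.1 x ∨ (M x : ℝ) < η.1 x ∧ (M x : ℝ) < η'.1 x) : RegionLE M η η' := by
  refine ⟨{x | η.1 x = η'.1 x}, by simp [η.2, η'.2], fun x hx => (h x).resolve_left hx,
    fun x hx y hy => ?_⟩
  rw [← show η.1 x = η'.1 x from hx, ← show η.1 y = η'.1 y from hy]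
  exact self_mem_intHull _

/-- Finitely many regions suffice. -/
theorem exists_regionClass (M : Fin (n + 1) → ℤ) (hM : ∀ x, 0 ≤ M x) (hM0 : M 0 = 0) :
    ∃ f : ClockVal n → Fin (n + 1) → Fin (n + 1) → ℤ × ℤ, (Set.range f).Finite ∧
      ∀ η η', f η = f η' → RegionLE M η η' := by
  -- Capping at `M x + 1` bounds all differences but still shows whether a clock exceeds `M x`.
  -- Floors and ceilings of the capped differences classify the valuations.
  let m : ClockVal n → Fin (n + 1) → ℝ := fun η x => min (η.1 x) (M x + 1)
  have hMr : ∀ x, (0 : ℝ) ≤ M x := fun x => by exact_mod_cast hM x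
  have hm0 : ∀ η x, 0 ≤ m η x := fun η x => le_min (η.1 x).2 (by linarith [hMr x])
  have hm1 : ∀ η x, m η x ≤ M x + 1 := fun η x => min_le_right _ _
  have hmz : ∀ η, m η 0 = 0 := fun η => by simp [m, η.2, hM0]
  have hlarge : ∀ η x, (M x : ℝ) < η.1 x ↔ M x < ⌈m η x - m η 0⌉ := by
    intro η x
    rw [hmz, sub_zero, Int.lt_ceil, lt_min_iff]
    simp
  refine ⟨fun η x y => (⌊m η x - m η y⌋, ⌈m η x - m η y⌉), ?_, fun η η' h => ?_⟩
  · refine Set.Finite.subset (Set.Finite.pi' fun x => Set.Finite.pi' fun y =>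
      (Set.finite_Icc (-(M y + 1)) (M x + 1)).prod (Set.finite_Icc (-(M y + 1)) (M x + 1))) ?_
    rintro _ ⟨η, rfl⟩ x y
    have h1 := hm0 η x
    have h2 := hm0 η y
    have h3 := hm1 η x
    have h4 := hm1 η y
    refine ⟨⟨?_, ?_⟩, ⟨?_, ?_⟩⟩
    · exact Int.le_floor.2 (by push_cast; linarith)
    · exact Int.cast_le.1 ((Int.floor_le _).trans (by push_cast; linarith : _ ≤ ((M x + 1 : ℤ) : ℝ)))
    · exact Int.cast_le.1 ((by push_cast; linarith : ((-(M y + 1) : ℤ) : ℝ) ≤ _).trans (Int.le_ceil _))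
    · exact Int.ceil_le.2 (by push_cast; linarith)
  · have hfl : ∀ x y, ⌊m η x - m η y⌋ = ⌊m η' x - m η' y⌋ := fun x y =>
      congrArg Prod.fst (congrFun (congrFun h x) y)
    have hce : ∀ x y, ⌈m η x - m η y⌉ = ⌈m η' x - m η' y⌉ := fun x y =>
      congrArg Prod.snd (congrFun (congrFun h x) y)
    have hiff : ∀ x, (M x : ℝ) < η.1 x ↔ (M x : ℝ) < η'.1 x := fun x => by
      rw [hlarge, hlarge, hce]
    refine ⟨{x | ¬ (M x : ℝ) < η.1 x}, by simp [η.2, hM0], fun x hx => ?_, fun x hx y hy => ?_⟩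
    · have := not_not.1 hx
      exact ⟨this, (hiff x).1 this⟩
    · have hval : ∀ z, ¬ (M z : ℝ) < η.1 z → m η z = η.1 z ∧ m η' z = η'.1 z := by
        intro z hz
        have hz' := mt (hiff z).2 hz
        exact ⟨min_eq_left (by linarith), min_eq_left (by linarith)⟩
      have := mem_intHull_of_ceil (hce x y) (hfl x y)
      rwa [(hval x hx).1, (hval x hx).2, (hval y hy).1, (hval y hy).2] at this

end ParTimed

namespace ParTimed

open scoped Pointwise

variable {L P : Type*} [Fintype P] {n : ℕ} {lb ub v : P → ℤ}

/-! ### The maximal constants and the invariance of guards -/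

theorem PTBA.atoms_finite {Q : Type*} [Finite L] (A : PTBA L Q n) : A.atoms.Finite := by
  refine Set.Finite.subset ((A.edges_finite.biUnion fun t _ => List.finite_toSet t.2.1).union
    (Set.finite_iUnion fun l => List.finite_toSet (A.inv l))) ?_
  rintro a (⟨t, ht, ha⟩ | ⟨l, ha⟩)
  · exact Or.inl (Set.mem_biUnion ht ha)
  · exact Or.inr (Set.mem_iUnion.2 ⟨l, ha⟩)

/-- Ensures that the `sSup` in `maxConst` is an upper bound and not a default value. -/
theorem PTBA.bddAbove_comparedConsts [Finite L] (A : PTBA L P n) (lb ub : P → ℤ)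
    (x : Fin (n + 1)) : BddAbove (insert 0 (A.comparedConsts lb ub x)) := by
  refine (Set.Finite.insert 0 (Set.Finite.subset ((A.atoms_finite.image fun a =>
    a.expr.maxVal lb ub).union (A.atoms_finite.image fun a => (-a.expr).maxVal lb ub)) ?_)).bddAbove
  rintro m ⟨-, a, ha, ⟨-, -, rfl⟩ | ⟨-, -, rfl⟩⟩
  · exact Or.inl ⟨a, ha, rfl⟩
  · exact Or.inr ⟨a, ha, rfl⟩

theorem PTBA.maxConst_zero (A : PTBA L P n) : A.maxConst lb ub 0 = 0 := by
  have : A.comparedConsts lb ub 0 = ∅ := by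
    ext m; simp [PTBA.comparedConsts]
  simp [PTBA.maxConst, this]

theorem PTBA.maxConst_nonneg [Finite L] (A : PTBA L P n) (x : Fin (n + 1)) :
    0 ≤ A.maxConst lb ub x :=
  le_csSup (A.bddAbove_comparedConsts lb ub x) (Set.mem_insert _ _)

theorem PTBA.le_maxConst [Finite L] (A : PTBA L P n) {x : Fin (n + 1)} {m : ℤ}
    (hm : m ∈ A.comparedConsts lb ub x) : m ≤ A.maxConst lb ub x :=
  le_csSup (A.bddAbove_comparedConsts lb ub x) (Set.mem_insert_of_mem _ hm)

/-- If both clocks lie in `X`, the atom is an integer bound on their difference. Otherwise one of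
them is `x_0` and the other exceeds `M` in both valuations: a lower bound then holds for `η'`, and
an upper bound cannot have held for `η`. -/
theorem RegionLE.atom_sat [Finite L] {A : PTBA L P n} (hv : v ∈ Val lb ub) {η η' : ClockVal n}
    (h : RegionLE (A.maxConst lb ub) η η') {a : SimpleAtom n P} (ha : a ∈ A.atoms)
    (hη : a.Sat v η) : a.Sat v η' := by
  obtain ⟨X, h0, hl, hs⟩ := h
  rcases a with ⟨i, j, r, e, hij⟩
  by_cases hX : i ∈ X ∧ j ∈ X
  · have := hs i hX.1 j hX.2 (e.eval v)
    unfold SimpleAtom.Sat Rel at *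
    cases r
    · simpa using this.2 (by simpa using hη)
    · simpa using this.1 (by simpa using hη)
  · rcases hij with rfl | rfl
    · have hj : j ∉ X := fun h => hX ⟨h0, h⟩
      have hj0 : j ≠ 0 := by rintro rfl; exact hj h0
      have h1 : -e.eval v ≤ A.maxConst lb ub j := by
        rw [← AffExpr.eval_neg]
        exact (AffExpr.eval_le_maxVal _ hv).trans
          (A.le_maxConst ⟨hj0, _, ha, Or.inr ⟨rfl, rfl, rfl⟩⟩)
      have h2 : (-e.eval v : ℝ) ≤ A.maxConst lb ub j := by exact_mod_cast h1
      have h3 : ((η'.1 0 : ℝ) - η'.1 j) < (e.eval v : ℝ) := by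
        rw [η'.coe_zero]
        linarith [(hl j hj).2]
      unfold SimpleAtom.Sat Rel
      split_ifs
      · exact h3.le
      · exact h3
    · have hi : i ∉ X := fun h => hX ⟨h, h0⟩
      have hi0 : i ≠ 0 := by rintro rfl; exact hi h0
      have h1 : e.eval v ≤ A.maxConst lb ub i :=
        (AffExpr.eval_le_maxVal _ hv).trans
          (A.le_maxConst ⟨hi0, _, ha, Or.inl ⟨rfl, rfl, rfl⟩⟩)
      have h2 : (e.eval v : ℝ) ≤ A.maxConst lb ub i := by exact_mod_cast h1
      have h3 : (e.eval v : ℝ) < ((η.1 i : ℝ) - η.1 0) := by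
        rw [η.coe_zero]
        linarith [(hl i hi).1]
      have h4 : (η.1 i : ℝ) - η.1 0 ≤ (e.eval v : ℝ) := by
        unfold SimpleAtom.Sat Rel at hη
        split_ifs at hη
        · exact hη
        · exact hη.le
      exact absurd h4 (not_le.2 h3)

theorem RegionLE.inv_sat [Finite L] {A : PTBA L P n} (hv : v ∈ Val lb ub) {η η' : ClockVal n}
    (h : RegionLE (A.maxConst lb ub) η η') {l : L} (hη : (A.inv l).Sat v η) :
    (A.inv l).Sat v η' :=
  fun a ha => h.atom_sat hv (Or.inr ⟨l, ha⟩) (hη a ha)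

theorem RegionLE.guard_sat [Finite L] {A : PTBA L P n} (hv : v ∈ Val lb ub) {η η' : ClockVal n}
    (h : RegionLE (A.maxConst lb ub) η η') {l l' : L} {g : SimpleGuard n P}
    {R : Finset (Fin (n + 1))} (ht : (l, g, R, l') ∈ A.edges) (hη : g.Sat v η) : g.Sat v η' :=
  fun a ha => h.atom_sat hv (Or.inl ⟨_, ht, ha⟩) (hη a ha)

theorem PTBA.simulated_of_regionLE [Finite L] {A : PTBA L P n} (hv : v ∈ Val lb ub)
    {η η' : ClockVal n} (h : RegionLE (A.maxConst lb ub) η η') (l : L) :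
    A.Simulated v (l, η) (l, η') := by
  refine ⟨fun s s' => s.1 = s'.1 ∧ RegionLE (A.maxConst lb ub) s.2 s'.2,
    ⟨fun s s' h => h.1, ?_, ?_⟩, rfl, h⟩
  · rintro ⟨l, η⟩ ⟨_, η'⟩ ⟨l₁, η₁⟩ ⟨rfl, h⟩ ⟨g, R, ht, hg, rfl, hi⟩
    exact ⟨(l₁, η'.reset R), ⟨g, R, ht, h.guard_sat hv ht hg, rfl, (h.reset R).inv_sat hv hi⟩,
      rfl, h.reset R⟩
  · rintro ⟨l, η⟩ ⟨_, η'⟩ ⟨l₁, η₁⟩ d ⟨rfl, h⟩ ⟨h1, rfl, hi⟩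
    obtain ⟨d', hd'⟩ := h.delay d
    exact ⟨d', (l₁, η'.delay d'), ⟨h1, rfl, hd'.inv_sat hv hi⟩, rfl, hd'⟩

/-! ### Matrices that entail the non-negativity of the clocks -/

/-- The bounds in row `0` and on the diagonal are at most `0`. -/
def CMatrix.Clocked (lb ub : P → ℤ) (Z : CMatrix n P) : Prop :=
  ∀ v ∈ semC lb ub Z.C, (∀ i, Z.slice v 0 i ⊆ Set.Iic 0) ∧ ∀ i, Z.slice v i i ⊆ Set.Iic 0

theorem Bound.sols_subset_Iic_zero (b : Bound P) :
    b.sols v ⊆ Set.Iic 0 ↔ ExtExpr.eval b.expr v ≤ 0 := by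
  simpa using Bound.sols_subset_Iic (v := v) b 0

theorem AffExpr.eval_zero (v : P → ℤ) : (0 : AffExpr P).eval v = 0 := AffExpr.eval_ofInt 0 v

theorem CMatrix.IsCPDBM.clocked {Z : CMatrix n P} (h : Z.IsCPDBM lb ub) : Z.Clocked lb ub := by
  refine fun v hv => ⟨fun i => ?_, fun i => ?_⟩
  · have := h.2 i v hv
    exact (Bound.sols_subset_Iic_zero _).2 (by simpa [Constraint.Sat, Rel] using this)
  · refine (Bound.sols_subset_Iic_zero _).2 ?_
    rw [h.1 i, ExtExpr.eval_coe, AffExpr.eval_zero]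
    rfl

/-- Relaxation can change the diagonal expressions, so the syntactic condition `IsCPDBM` need not
survive the algorithm. The semantic condition is monotone and does. -/
theorem CMatrix.Clocked.of_refines {Z Z' : CMatrix n P} (h : Z.Clocked lb ub)
    (hr : ∀ v, Z'.Refines lb ub v Z) : Z'.Clocked lb ub := fun v hv =>
  ⟨fun i => ((hr v hv).2 0 i).trans ((h v (hr v hv).1).1 i),
    fun i => ((hr v hv).2 i i).trans ((h v (hr v hv).1).2 i)⟩

open Classical in
/-- The bounds on the diagonal can be turned into constraints on the parameters. -/
theorem CMatrix.Clocked.exists_isCPDBM {Z : CMatrix n P} (h : Z.Clocked lb ub) :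
    ∃ Z' : CMatrix n P, Z'.IsCPDBM lb ub ∧ Z.sem lb ub = Z'.sem lb ub := by
  -- The condition that `0` satisfies the diagonal bound involves no clock. It moves into the
  -- constraint set, which frees the diagonal to be `≤ 0`.
  let C' : Finset (Constraint P) := Finset.univ.image fun i : Fin (n + 1) =>
    ⟨ExtExpr.ofInt 0, (Z.D i i).rel, (Z.D i i).expr⟩
  let Z' : CMatrix n P := ⟨Z.C ∪ C', fun i j => if i = j then
    ⟨true, ((0 : AffExpr P) : WithTop _)⟩ else Z.D i j⟩
  have hdiag : ∀ v i, (⟨ExtExpr.ofInt 0, (Z.D i i).rel, (Z.D i i).expr⟩ : Constraint P).Sat v →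
      (0 : ℝ) ∈ Z.slice v i i := by
    intro v i hc
    refine Bound.sols_subset_of_tighter (b := ⟨true, ExtExpr.ofInt 0⟩) (b' := Z.D i i) ?_ ?_
    · simpa [Bound.tighter] using hc
    · rw [ExtExpr.ofInt, Bound.sols_le]
      simp
  have hdiag' : ∀ v i, (0 : ℝ) ∈ Z.slice v i i →
      (⟨ExtExpr.ofInt 0, (Z.D i i).rel, (Z.D i i).expr⟩ : Constraint P).Sat v := by
    intro v i h0
    by_contra hc
    rw [← Constraint.neg_sat] at hc
    have := Bound.sols_subset_of_tighter (b := Z.D i i) (b' := ⟨false, ExtExpr.ofInt 0⟩)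
      (by simpa [Bound.tighter, Constraint.neg] using hc) h0
    rw [ExtExpr.ofInt, Bound.sols_lt] at this
    simp at this
  have hsem : ∀ v, v ∈ semC lb ub Z'.C ↔ v ∈ semC lb ub Z.C ∧ ∀ i, (0 : ℝ) ∈ Z.slice v i i := by
    intro v
    rw [semC_union]
    refine and_congr_right fun _ => ⟨fun h i => hdiag v i (h _ (Finset.mem_image_of_mem _ (Finset.mem_univ i))), fun h c hc => ?_⟩
    obtain ⟨i, -, rfl⟩ := Finset.mem_image.1 hc
    exact hdiag' v i (h i)
  refine ⟨Z', ⟨fun i => by simp [Z'], fun i v hv => ?_⟩, ?_⟩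
  · rcases eq_or_ne 0 i with rfl | hi
    · change Rel true (ExtExpr.eval (Z'.D 0 0).expr v) (ExtExpr.eval (ExtExpr.ofInt 0) v)
      rw [show (Z'.D 0 0).expr = ExtExpr.ofInt 0 from rfl]
      exact le_rfl
    · have := (Bound.sols_subset_Iic_zero _).1 ((h v ((hsem v).1 hv).1).1 i)
      simpa [Z', hi, Constraint.Sat, Rel] using this
  · ext ⟨v, η⟩
    rw [CMatrix.mem_sem, CMatrix.mem_sem, hsem]
    constructor
    · rintro ⟨h1, h2⟩
      refine ⟨⟨h1, fun i => by simpa using h2 i i⟩, fun i j => ?_⟩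
      by_cases hij : i = j
      · subst hij
        simp only [CMatrix.slice, Z', if_true, Bound.sols_le, AffExpr.eval_zero]
        simp
      · simpa only [CMatrix.slice, Z', if_neg hij] using h2 i j
    · rintro ⟨⟨h1, h2⟩, h3⟩
      refine ⟨h1, fun i j => ?_⟩
      by_cases hij : i = j
      · subst hij
        simpa using h2 i
      · simpa only [CMatrix.slice, Z', if_neg hij] using h3 i j

theorem CMatrix.Clocked.mem_symStates {Z : CMatrix n P} (h : Z.Clocked lb ub) {S : SymState L P n}
    (hS : S.zone = Z.sem lb ub) : S ∈ symStates L n lb ub := by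
  obtain ⟨Z', h1, h2⟩ := h.exists_isCPDBM
  exact ⟨Z', h1, hS.trans h2⟩

/-! ### Resets and time successors -/

/-- Off the diagonal, successive resets amount to one simultaneous replacement of the indices in `R`
by `0`, so their order is irrelevant. -/
theorem PMatrix.resets_apply {Q : Type*} (D : PMatrix n Q) (R : Finset (Fin (n + 1)))
    (i j : Fin (n + 1)) : D.resets R i j =
      if i = j then D i j else D (if i ∈ R then 0 else i) (if j ∈ R then 0 else j) := by
  have key : ∀ (l : List (Fin (n + 1))) (D : PMatrix n Q), l.foldl PMatrix.reset D i j =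
      if i = j then D i j else D (if i ∈ l then 0 else i) (if j ∈ l then 0 else j) := by
    intro l
    induction l with
    | nil => simp
    | cons r l ih =>
      intro D
      rw [List.foldl_cons, ih]
      simp only [PMatrix.reset, List.mem_cons]
      grind
  rw [PMatrix.resets, key]
  simp

theorem CMatrix.mem_sem_resets_up {Z : CMatrix n P} {η : ClockVal n}
    (hη : (v, η) ∈ Z.sem lb ub) (R : Finset (Fin (n + 1))) (d : ℝ≥0) :
    (v, (η.reset R).delay d) ∈
      (⟨Z.C, (Z.D.resets R).up⟩ : CMatrix n P).sem lb ub := by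
  refine CMatrix.mem_sem.2 ⟨hη.1, fun i j => ?_⟩
  simp only [CMatrix.slice, PMatrix.up, PMatrix.resets_apply]
  by_cases h1 : i ≠ 0 ∧ j = 0
  · rw [if_pos h1, Bound.sols_top]; trivial
  rw [if_neg h1]
  rcases eq_or_ne i j with rfl | h2
  · rw [if_pos rfl, sub_self, ← sub_self (η.1 i : ℝ)]
    exact hη.2 i i
  · rw [if_neg h2]
    have := (CMatrix.mem_sem.1 hη).2 (if i ∈ R then 0 else i) (if j ∈ R then 0 else j)
    have hj0 : j ≠ 0 := by rintro rfl; exact h1 ⟨h2, rfl⟩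
    by_cases hi0 : i = 0
    · subst hi0
      rw [ClockVal.coe_delay _ _ hj0, ClockVal.coe_zero, ClockVal.coe_reset]
      refine Bound.isLowerSet_sols _ ?_ this
      simp only [ite_self]
      rw [ClockVal.coe_zero]
      have : (0 : ℝ) ≤ d := d.2
      linarith
    · rw [ClockVal.coe_delay _ _ hj0, ClockVal.coe_delay _ _ hi0, ClockVal.coe_reset,
        ClockVal.coe_reset, add_sub_add_right_eq_sub]
      exact this

/-- The unknowns are `q i = η₀ i + d`, with `q 0 = d`. They agree with `η` on the clocks that are
not reset, and `q 0` is the common value of the reset clocks, if there are any. The remaining values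
come from the extension theorem, since the matrix is closed. -/
theorem CMatrix.exists_reset_delay {Z : CMatrix n P} (hZ : Z.Clocked lb ub)
    (hT : (∀ i, (0 : ℝ) ∈ Z.slice v i i) → Triangle (Z.slice v)) {R : Finset (Fin (n + 1))}
    {η : ClockVal n}
    (hη : (v, η) ∈ (⟨Z.C, (Z.D.resets R).up⟩ : CMatrix n P).sem lb ub) :
    ∃ η₀ d, (v, η₀) ∈ Z.sem lb ub ∧ η = (η₀.reset R).delay d := by
  obtain ⟨hv, hη⟩ := CMatrix.mem_sem.1 hη
  simp only [CMatrix.slice, PMatrix.up, PMatrix.resets_apply] at hη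
  have h0 : ∀ i, (0 : ℝ) ∈ Z.slice v i i := fun i => by
    have := hη i i
    rw [if_neg (by tauto), if_pos rfl, sub_self] at this
    exact this
  have hT := hT h0
  obtain ⟨hrow, hdiag⟩ := hZ v hv
  have hent : ∀ i j, i ≠ j → j ≠ 0 → (η.1 i : ℝ) - η.1 j ∈
      Z.slice v (if i ∈ R then 0 else i) (if j ∈ R then 0 else j) := by
    intro i j hij hj
    have := hη i j
    rwa [if_neg (by tauto), if_neg hij] at this
  have h00 : Z.slice v 0 0 = Set.Iic 0 :=
    (hdiag 0).antisymm fun r hr => Z.isLowerSet_slice 0 0 hr (h0 0)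
  -- The positions of the clocks when the present time is `0` and time runs backwards.
  obtain ⟨d₀, hd₀, hdR⟩ : ∃ d₀ : ℝ, 0 ≤ d₀ ∧ ∀ r ∈ R, r ≠ 0 → (η.1 r : ℝ) = d₀ := by
    by_cases hR : ∃ r ∈ R, r ≠ 0
    · obtain ⟨r, hr, hr0⟩ := hR
      have key : ∀ r ∈ R, r ≠ 0 → ∀ s ∈ R, s ≠ 0 → (η.1 r : ℝ) ≤ η.1 s := by
        intro r hr hr0 s hs hs0
        rcases eq_or_ne r s with rfl | hrs
        · exact le_rfl
        · have := hent r s hrs hs0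
          rw [if_pos hr, if_pos hs, h00] at this
          simpa using this
      exact ⟨η.1 r, (η.1 r).2, fun s hs hs0 => (key s hs hs0 r hr hr0).antisymm
        (key r hr hr0 s hs hs0)⟩
    · exact ⟨0, le_rfl, fun r hr hr0 => absurd ⟨r, hr, hr0⟩ hR⟩
  let p : Fin (n + 1) → ℝ := fun i => if i = 0 then d₀ else η.1 i
  -- The extra row with `c = 0` is there for its entry at `0`: it gives `-q 0 ≤ 0`, that is, a
  -- non-negative delay, also when no clock fixes it.
  obtain ⟨q, hq, hqS, hqT⟩ := Triangle.exists_extension (κ := Unit) (T := fun _ => Z.slice v 0)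
    (c := fun _ => 0) hT Z.isLowerSet_slice Z.slice_nonempty h0 (fun _ k j => hT 0 k j)
    (fun _ => Z.isLowerSet_slice 0) (fun _ => Z.slice_nonempty 0)
    {i | (i ≠ 0 ∧ i ∉ R) ∨ (i = 0 ∧ ∃ r ∈ R, r ≠ 0)} p
    (by
      rintro i hi j hj
      rcases eq_or_ne i j with rfl | hij
      · simpa using h0 i
      rcases hi with ⟨hi, hiR⟩ | ⟨rfl, r, hr, hr0⟩ <;> rcases hj with ⟨hj, hjR⟩ | ⟨rfl, s, hs, hs0⟩
      · simpa [p, hi, hj, hiR, hjR] using hent i j hij hj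
      · have := hent i s (by rintro rfl; exact hiR hs) hs0
        simpa [p, hi, hiR, hs, hdR s hs hs0] using this
      · have := hent r j (by rintro rfl; exact hjR hr) hj
        simpa [p, hj, hjR, hr, hdR r hr hr0] using this
      · exact absurd rfl hij)
    (by
      rintro - j (⟨hj, hjR⟩ | ⟨rfl, r, hr, hr0⟩)
      · have := hent 0 j hj.symm hj
        simpa [p, hj, hjR, η.2] using this
      · rw [h00]
        simpa [p] using hd₀)
  have hq0 : 0 ≤ q 0 := by
    have := hqT () 0
    rw [h00] at this
    simpa using this
  have hqi : ∀ i, 0 ≤ q i - q 0 := fun i => by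
    have := hrow i (hqS 0 i)
    simp only [Set.mem_Iic] at this
    linarith
  obtain ⟨η₀, hη₀⟩ : ∃ η₀ : ClockVal n, ∀ i, (η₀.1 i : ℝ) = q i - q 0 :=
    ⟨⟨fun i => ⟨q i - q 0, hqi i⟩, NNReal.coe_injective (sub_self _)⟩, fun _ => rfl⟩
  obtain ⟨d, hd⟩ : ∃ d : ℝ≥0, (d : ℝ) = q 0 := ⟨⟨q 0, hq0⟩, rfl⟩
  refine ⟨η₀, d, CMatrix.mem_sem.2 ⟨hv, fun i j => ?_⟩, ?_⟩
  · rw [hη₀, hη₀]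
    simpa using hqS i j
  · apply Subtype.ext
    funext i
    apply NNReal.coe_injective
    rcases eq_or_ne i 0 with rfl | hi
    · exact η.coe_zero.trans (ClockVal.coe_zero _).symm
    · rw [ClockVal.coe_delay _ _ hi, ClockVal.coe_reset, hη₀, hd]
      split_ifs with hiR
      · have : q 0 = p 0 := hq 0 (Or.inr ⟨rfl, i, hiR, hi⟩)
        rw [hdR i hiR hi, this]
        simp [p]
      · have : q i = p i := hq i (Or.inl ⟨hi, hiR⟩)
        rw [this]
        simp [p, hi]

theorem CMatrix.Clocked.resets_up {Z : CMatrix n P} (h : Z.Clocked lb ub)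
    (R : Finset (Fin (n + 1))) :
    (⟨Z.C, (Z.D.resets R).up⟩ : CMatrix n P).Clocked lb ub := by
  refine fun v hv => ⟨fun i => ?_, fun i => ?_⟩
  · simp only [CMatrix.slice, PMatrix.up, PMatrix.resets_apply]
    rw [if_neg (by tauto)]
    split_ifs
    all_goals exact (h v hv).1 _
  · simp only [CMatrix.slice, PMatrix.up, PMatrix.resets_apply]
    rw [if_neg (by tauto), if_pos trivial]
    exact (h v hv).2 i

end ParTimed

namespace ParTimed

open scoped Pointwise

variable {L P : Type*} [Fintype P] {n : ℕ} {lb ub v : P → ℤ}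

/-! ### Transitions of the symbolic semantics -/

/-- Rests on the canonical form `Z₂` taken before the reset: its closure lets the erased values be
recovered. The invariant is obtained after the delay only, not on entry. -/
theorem PTBA.SymTrans.exists_pred {A : PTBA L P n} {S S' : SymState L P n}
    (h : A.SymTrans lb ub S S') : ∃ g R, (S.loc, g, R, S'.loc) ∈ A.edges ∧
      ∀ v η, (v, η) ∈ S'.zone → ∃ η₀ d, (v, η₀) ∈ S.zone ∧ g.Sat v η₀ ∧
        η = (η₀.reset R).delay d ∧ (A.inv S'.loc).Sat v η := by
  obtain ⟨Z, hZ, hS, g, R, ht, Z₁, h1, Z₂, h2, Z₃, h3, Z₄, h4, hS'⟩ := h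
  refine ⟨g, R, ht, fun v η hη => ?_⟩
  rw [hS'] at hη
  have hη3 := (CMatrix.refines_of_mem_canon h4).mem_sem hη
  have hZ₂ : Z₂.Clocked lb ub := hZ.clocked.of_refines fun v =>
    (CMatrix.refines_of_mem_canon h2).trans (CMatrix.refines_of_mem_applyGuard h1)
  obtain ⟨η₀, d, hη₀, hd⟩ := CMatrix.exists_reset_delay hZ₂
    (CMatrix.triangle_of_mem_canon h2 ((CMatrix.refines_of_mem_applyGuard h3).mem_sem hη3).1)
    ((CMatrix.refines_of_mem_applyGuard h3).mem_sem hη3)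
  have hη1 := (CMatrix.refines_of_mem_canon h2).mem_sem hη₀
  refine ⟨η₀, d, ?_, CMatrix.sat_of_mem_applyGuard h1 hη1, hd,
    CMatrix.sat_of_mem_applyGuard h3 hη3⟩
  rw [hS]
  exact (CMatrix.refines_of_mem_applyGuard h1).mem_sem hη1

theorem PTBA.exists_symTrans {A : PTBA L P n} {S : SymState L P n}
    (hS : S ∈ symStates L n lb ub) {η : ClockVal n} (hη : (v, η) ∈ S.zone) {l' : L}
    {g : SimpleGuard n P} {R : Finset (Fin (n + 1))} (ht : (S.loc, g, R, l') ∈ A.edges)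
    (hg : g.Sat v η) (d : ℝ≥0) (hi : (A.inv l').Sat v ((η.reset R).delay d)) :
    ∃ S' ∈ symStates L n lb ub, A.SymTrans lb ub S S' ∧ S'.loc = l' ∧
      (v, (η.reset R).delay d) ∈ S'.zone := by
  obtain ⟨Z, hZ, hSZ⟩ := hS
  rw [hSZ] at hη
  obtain ⟨Z₁, h1, hη1⟩ := CMatrix.exists_mem_applyGuard hη hg
  obtain ⟨Z₂, h2, hv2⟩ := CMatrix.exists_mem_canon hη1.1
  have hη2 := CMatrix.mem_sem_of_mem_canon h2 hη1 hv2
  obtain ⟨Z₃, h3, hη3⟩ := CMatrix.exists_mem_applyGuard (CMatrix.mem_sem_resets_up hη2 R d) hi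
  obtain ⟨Z₄, h4, hv4⟩ := CMatrix.exists_mem_canon hη3.1
  have hZ₂ : Z₂.Clocked lb ub := hZ.clocked.of_refines fun v =>
    (CMatrix.refines_of_mem_canon h2).trans (CMatrix.refines_of_mem_applyGuard h1)
  have hZ₄ : Z₄.Clocked lb ub := (hZ₂.resets_up R).of_refines fun v =>
    (CMatrix.refines_of_mem_canon h4).trans (CMatrix.refines_of_mem_applyGuard h3)
  exact ⟨⟨l', Z₄.sem lb ub⟩, hZ₄.mem_symStates rfl,
    ⟨Z, hZ, hSZ, g, R, ht, Z₁, h1, Z₂, h2, Z₃, h3, Z₄, h4, rfl⟩, rfl,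
    CMatrix.mem_sem_of_mem_canon h4 hη3 hv4⟩

/-! ### Initial states of the symbolic semantics -/

theorem mem_semC_boundConstraints (hv : v ∈ Val lb ub) :
    v ∈ semC lb ub (boundConstraints lb ub) := by
  classical
  refine ⟨hv, fun c hc => ?_⟩
  rcases Finset.mem_union.1 hc with hc | hc
  · obtain ⟨p, -, rfl⟩ := Finset.mem_image.1 hc
    simpa [Constraint.Sat, Rel] using (hv p).1
  · obtain ⟨p, -, rfl⟩ := Finset.mem_image.1 hc
    simpa [Constraint.Sat, Rel] using (hv p).2

theorem slice_zeroMatrix_up (C : Finset (Constraint P)) (i j : Fin (n + 1)) :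
    (⟨C, (zeroMatrix n P).up⟩ : CMatrix n P).slice v i j =
      if i ≠ 0 ∧ j = 0 then Set.univ else Set.Iic 0 := by
  simp only [CMatrix.slice, PMatrix.up, zeroMatrix]
  split_ifs
  · exact Bound.sols_top _
  · rw [ExtExpr.ofInt, Bound.sols_le]
    simp

theorem clocked_zeroMatrix_up (C : Finset (Constraint P)) :
    (⟨C, (zeroMatrix n P).up⟩ : CMatrix n P).Clocked lb ub := by
  refine fun v _ => ⟨fun i => ?_, fun i => ?_⟩
  · rw [slice_zeroMatrix_up, if_neg (by tauto)]
  · rw [slice_zeroMatrix_up, if_neg (by tauto)]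

theorem mem_sem_zeroMatrix_up_iff (hv : v ∈ Val lb ub) {η : ClockVal n} :
    (v, η) ∈ (⟨boundConstraints lb ub, (zeroMatrix n P).up⟩ : CMatrix n P).sem lb ub ↔
      ∃ d, η = (ClockVal.zero n).delay d := by
  rw [CMatrix.mem_sem, and_iff_right (mem_semC_boundConstraints hv)]
  simp only [slice_zeroMatrix_up]
  constructor
  · intro h
    have key : ∀ i j : Fin (n + 1), i ≠ 0 → j ≠ 0 → η.1 i = η.1 j := by
      have key : ∀ i j : Fin (n + 1), j ≠ 0 → η.1 i ≤ η.1 j := fun i j hj => by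
        have := h i j
        rw [if_neg (by tauto)] at this
        simpa using this
      exact fun i j hi hj => (key i j hj).antisymm (key j i hi)
    obtain ⟨d, hd⟩ : ∃ d, ∀ i ≠ 0, η.1 i = d := by
      by_cases h : ∃ i : Fin (n + 1), i ≠ 0
      · obtain ⟨i, hi⟩ := h
        exact ⟨η.1 i, fun j hj => key j i hj hi⟩
      · exact ⟨0, fun i hi => absurd ⟨i, hi⟩ h⟩
    refine ⟨d, Subtype.ext (funext fun i => ?_)⟩
    rcases eq_or_ne i 0 with rfl | hi
    · exact η.2.trans (ClockVal.delay _ _).2.symm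
    · simp [ClockVal.delay, ClockVal.zero, hi, hd i hi]
  · rintro ⟨d, rfl⟩ i j
    split_ifs with h
    · trivial
    · by_cases hj : j = 0
      · have hi : i = 0 := by tauto
        subst hi hj
        simp
      · by_cases hi : i = 0 <;> simp [ClockVal.delay, ClockVal.zero, hi, hj]

theorem PTBA.mem_symInit_spec {A : PTBA L P n} {S : SymState L P n} (hS : S ∈ A.symInit lb ub)
    (hv : v ∈ Val lb ub) {η : ClockVal n} (hη : (v, η) ∈ S.zone) :
    (∃ d, η = (ClockVal.zero n).delay d) ∧ (A.inv A.init).Sat v η := by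
  obtain ⟨-, Z, h1, h2⟩ := hS
  rw [h2] at hη
  exact ⟨(mem_sem_zeroMatrix_up_iff hv).1 ((CMatrix.refines_of_mem_applyGuard h1).mem_sem hη),
    CMatrix.sat_of_mem_applyGuard h1 hη⟩

theorem PTBA.symInit_subset {A : PTBA L P n} : A.symInit lb ub ⊆ symStates L n lb ub := by
  rintro S ⟨-, Z, h1, h2⟩
  exact ((clocked_zeroMatrix_up _).of_refines fun v =>
    CMatrix.refines_of_mem_applyGuard h1).mem_symStates h2

theorem PTBA.exists_mem_symInit {A : PTBA L P n} (hv : v ∈ Val lb ub) (d : ℝ≥0)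
    (hi : (A.inv A.init).Sat v ((ClockVal.zero n).delay d)) :
    ∃ S ∈ A.symInit lb ub, (v, (ClockVal.zero n).delay d) ∈ S.zone := by
  obtain ⟨Z, h1, h2⟩ := CMatrix.exists_mem_applyGuard
    ((mem_sem_zeroMatrix_up_iff hv).2 ⟨d, rfl⟩) hi
  exact ⟨⟨A.init, Z.sem lb ub⟩, ⟨rfl, Z, h1, rfl⟩, h2⟩

/-! ### The pk-extrapolation -/

theorem mem_semC_pkSplit [DecidableEq (Constraint P)] {M : Fin (n + 1) → ℤ} {Z : CMatrix n P}
    {κ : Fin (n + 1) → Fin (n + 1) → PkCase} :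
    v ∈ semC lb ub (Z.C ∪ Finset.univ.biUnion (fun ij : Fin (n + 1) × Fin (n + 1) =>
        pkConstraints M ij.1 ij.2 (Z.D ij.1 ij.2) (κ ij.1 ij.2))) ↔
      v ∈ semC lb ub Z.C ∧
        ∀ i j, ∀ c ∈ pkConstraints M i j (Z.D i j) (κ i j), c.Sat v := by
  rw [semC_union]
  simp only [Finset.mem_biUnion, Finset.mem_univ, true_and, Prod.exists]
  exact and_congr_right fun _ => ⟨fun h i j c hc => h c ⟨i, j, hc⟩,
    fun h c ⟨i, j, hc⟩ => h i j c hc⟩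

/-- The effect of the extrapolation on the entries, under a valuation. -/
theorem CMatrix.slice_of_mem_pkSplit {M : Fin (n + 1) → ℤ} {Z Z' : CMatrix n P}
    (h : Z' ∈ Z.pkSplit M) (hv : v ∈ semC lb ub Z'.C) :
    v ∈ semC lb ub Z.C ∧ ∀ i j,
      (Z'.slice v i j = Z.slice v i j ∧ ExtExpr.eval (Z.D i j).expr v ≤ (M i : WithTop ℤ) ∧
        ((-M j : ℤ) : WithTop ℤ) ≤ ExtExpr.eval (Z.D i j).expr v) ∨
      (Z'.slice v i j = Set.univ ∧ ∃ r ∈ Z.slice v i j, (M i : ℝ) < r) ∨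
      (Z'.slice v i j = Set.Iio (-M j : ℝ) ∧ Z.slice v i j ⊆ Set.Iio (-M j : ℝ)) := by
  classical
  obtain ⟨κ, rfl⟩ := h
  obtain ⟨h1, h2⟩ := mem_semC_pkSplit.1 (by convert hv)
  refine ⟨h1, fun i j => ?_⟩
  have h2 := h2 i j
  simp only [CMatrix.slice]
  cases hκ : κ i j <;> simp only [hκ, pkConstraints, pkBound, Finset.mem_insert,
    Finset.mem_singleton, forall_eq_or_imp, forall_eq, Constraint.Sat, Rel, if_true,
    ExtExpr.eval_ofInt] at h2 ⊢
  · exact Or.inl ⟨trivial, h2.1, h2.2⟩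
  · exact Or.inr (Or.inl ⟨Bound.sols_top _, ((Z.D i j).lt_eval _).1 h2⟩)
  · refine Or.inr (Or.inr ⟨?_, ?_⟩)
    · rw [ExtExpr.ofInt, Bound.sols_lt]
      simp
    · have := Bound.sols_subset_of_tighter (v := v) (b := Z.D i j)
        (b' := ⟨false, ExtExpr.ofInt (-M j)⟩) (by
          simp only [Bound.tighter, Constraint.Sat, Rel, ExtExpr.eval_ofInt]
          split_ifs
          · exact le_of_lt h2
          · exact h2)
      rw [ExtExpr.ofInt, Bound.sols_lt] at this
      simpa using this

/-- The three cases exhaust all values of a bound, so `v` itself selects a case for each entry. -/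
theorem CMatrix.exists_mem_pkSplit (M : Fin (n + 1) → ℤ) {Z : CMatrix n P}
    (hv : v ∈ semC lb ub Z.C) :
    ∃ Z' ∈ Z.pkSplit M, v ∈ semC lb ub Z'.C := by
  classical
  let κ : Fin (n + 1) → Fin (n + 1) → PkCase := fun i j =>
    if (M i : WithTop ℤ) < ExtExpr.eval (Z.D i j).expr v then .drop
    else if ExtExpr.eval (Z.D i j).expr v < ((-M j : ℤ) : WithTop ℤ) then .clip else .keep
  have hκ : ∀ i j, ∀ c ∈ pkConstraints M i j (Z.D i j) (κ i j), c.Sat v := by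
    intro i j
    by_cases h1 : (M i : WithTop ℤ) < ExtExpr.eval (Z.D i j).expr v
    · simp [κ, h1, pkConstraints, Constraint.Sat, Rel]
    · by_cases h2 : ExtExpr.eval (Z.D i j).expr v < ((-M j : ℤ) : WithTop ℤ)
      · simp only [κ, if_neg h1, if_pos h2, pkConstraints, Finset.mem_singleton, forall_eq,
          Constraint.Sat, Rel, ExtExpr.eval_ofInt]
        simpa using h2
      · simp only [κ, if_neg h1, if_neg h2, pkConstraints, Finset.mem_singleton, forall_eq,
          Finset.mem_insert, forall_eq_or_imp, Constraint.Sat, Rel, ExtExpr.eval_ofInt, if_true]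
        exact ⟨not_lt.1 h1, not_lt.1 h2⟩
  refine ⟨_, ⟨κ, rfl⟩, ?_⟩
  have := (mem_semC_pkSplit (lb := lb) (ub := ub)).2 ⟨hv, hκ⟩
  convert this

theorem CMatrix.slice_subset_of_mem_pkSplit {M : Fin (n + 1) → ℤ} {Z Z' : CMatrix n P}
    (h : Z' ∈ Z.pkSplit M) (hv : v ∈ semC lb ub Z'.C) (i j : Fin (n + 1)) :
    Z.slice v i j ⊆ Z'.slice v i j := by
  rcases (CMatrix.slice_of_mem_pkSplit h hv).2 i j with ⟨h, -⟩ | ⟨h, -⟩ | ⟨h, h'⟩ <;> rw [h]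
  · exact Set.subset_univ _
  · exact h'

/-- As `M ≥ 0`, an entry that is at most `0` is never dropped, and a clipped one is below `-M j ≤
0`. -/
theorem CMatrix.Clocked.of_mem_pkSplit {M : Fin (n + 1) → ℤ} (hM : ∀ x, 0 ≤ M x)
    {Z Z' : CMatrix n P} (hZ : Z.Clocked lb ub) (h : Z' ∈ Z.pkSplit M) : Z'.Clocked lb ub := by
  intro v hv
  obtain ⟨h1, h2⟩ := CMatrix.slice_of_mem_pkSplit h hv
  have hMr : ∀ x, (0 : ℝ) ≤ M x := fun x => by exact_mod_cast hM x
  have key : ∀ i j, Z.slice v i j ⊆ Set.Iic 0 → Z'.slice v i j ⊆ Set.Iic 0 := by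
    intro i j hs
    rcases h2 i j with ⟨h, -⟩ | ⟨-, r, hr, hMr'⟩ | ⟨h, -⟩
    · rwa [h]
    · have := hs hr
      simp only [Set.mem_Iic] at this
      linarith [hMr i]
    · rw [h]
      intro r hr
      simp only [Set.mem_Iic, Set.mem_Iio] at hr ⊢
      linarith [hMr j]
  exact ⟨fun i => key _ _ ((hZ v h1).1 i), fun i => key _ _ ((hZ v h1).2 i)⟩

/-- The extrapolation only adds clock valuations that agree with given ones, up to values that
exceed `M`. -/
theorem CMatrix.exists_mem_sem_of_mem_pkSplit {M : Fin (n + 1) → ℤ} (hM : ∀ x, 0 ≤ M x)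
    (hM0 : M 0 = 0) {Z Z' : CMatrix n P} (hZ : Z.Clocked lb ub) (h : Z' ∈ Z.pkSplit M)
    (hT : v ∈ semC lb ub Z.C → (∀ i, (0 : ℝ) ∈ Z.slice v i i) → Triangle (Z.slice v))
    {η : ClockVal n} (hη : (v, η) ∈ Z'.sem lb ub) :
    ∃ η₀, (v, η₀) ∈ Z.sem lb ub ∧ RegionLE M η η₀ := by
  obtain ⟨hv', hη⟩ := CMatrix.mem_sem.1 hη
  obtain ⟨hv, hsl⟩ := CMatrix.slice_of_mem_pkSplit h hv'
  have hMr : ∀ x, (0 : ℝ) ≤ M x := fun x => by exact_mod_cast hM x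
  have hcase : ∀ i j, (η.1 i : ℝ) - η.1 j ∈ Z.slice v i j ∨ (∃ r ∈ Z.slice v i j, (M i : ℝ) < r) ∨
      (η.1 i : ℝ) - η.1 j < -M j := by
    intro i j
    have := hη i j
    rcases hsl i j with ⟨h, -⟩ | ⟨-, h⟩ | ⟨h, -⟩
    · rw [h] at this; exact Or.inl this
    · exact Or.inr (Or.inl h)
    · rw [h] at this; exact Or.inr (Or.inr this)
  have h0 : ∀ i, (0 : ℝ) ∈ Z.slice v i i := by
    intro i
    rcases hcase i i with h | ⟨r, hr, hr'⟩ | h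
    · simpa using h
    · exact Z.isLowerSet_slice i i ((hMr i).trans hr'.le) hr
    · rw [sub_self] at h
      linarith [hMr i]
  have hT := hT hv h0
  have hpos : ∀ i, (0 : ℝ) ≤ η.1 i := fun i => (η.1 i).2
  -- Clocks at most `M` keep their values. For every other clock `y` a row with `c = M y` and strict
  -- versions of the bounds is added; its entry at `y` itself will force `q y > M y`.
  obtain ⟨q, hq, hqS, hqT⟩ := Triangle.exists_extension
    (κ := {y : Fin (n + 1) // (M y : ℝ) < η.1 y})
    (T := fun y i => {t | ∃ r ∈ Z.slice v y.1 i, t < r}) (c := fun y => (M y.1 : ℝ))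
    hT Z.isLowerSet_slice Z.slice_nonempty h0
    (by
      rintro y k j t ⟨r, hr, htr⟩
      obtain ⟨a, ha, b, hb, rfl⟩ := Set.mem_add.1 (hT y.1 k j hr)
      exact Set.mem_add.2 ⟨t - b, ⟨a, ha, by linarith⟩, b, hb, by ring⟩)
    (fun y j s t hts ⟨r, hr, hsr⟩ => ⟨r, hr, hts.trans_lt hsr⟩)
    (fun y j => by
      obtain ⟨r, hr⟩ := Z.slice_nonempty (v := v) y.1 j
      exact ⟨r - 1, r, hr, by linarith⟩)
    {x | (η.1 x : ℝ) ≤ M x} (fun x => η.1 x)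
    (by
      intro i hi j hj
      -- A dropped bound exceeds `M i ≥ η i - η j`, so it holds anyway; a clipped one would need `η
      -- j > M j`.
      rcases hcase i j with h | ⟨r, hr, hr'⟩ | h
      · exact h
      · refine Z.isLowerSet_slice i j ?_ hr
        have : (η.1 i : ℝ) ≤ M i := hi
        linarith [hpos j]
      · have : (η.1 j : ℝ) ≤ M j := hj
        linarith [hpos i])
    (by
      rintro ⟨y, hy⟩ i hi
      have hi : (η.1 i : ℝ) ≤ M i := hi
      rcases hcase y i with h | ⟨r, hr, hr'⟩ | h
      · exact ⟨_, h, by linarith⟩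
      · exact ⟨r, hr, by linarith [hpos i]⟩
      · linarith [hpos y])
  have hq0 : q 0 = 0 := by
    rw [hq 0 (by simp [η.2, hM0])]
    exact η.coe_zero
  have hqi : ∀ i, 0 ≤ q i := fun i => by
    have := (hZ v hv).1 i (hqS 0 i)
    rw [hq0] at this
    simpa using this
  obtain ⟨η₀, hη₀⟩ : ∃ η₀ : ClockVal n, ∀ i, (η₀.1 i : ℝ) = q i :=
    ⟨⟨fun i => ⟨q i, hqi i⟩, NNReal.coe_injective hq0⟩, fun _ => rfl⟩
  refine ⟨η₀, CMatrix.mem_sem.2 ⟨hv, fun i j => ?_⟩, RegionLE.of_eq_or_lt fun x => ?_⟩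
  · rw [hη₀, hη₀]
    exact hqS i j
  · rcases le_or_gt (η.1 x : ℝ) (M x) with hx | hx
    · refine Or.inl (NNReal.coe_injective ?_)
      rw [hη₀]
      exact (hq x hx).symm
    · refine Or.inr ⟨hx, ?_⟩
      rw [hη₀]
      obtain ⟨r, hr, hr'⟩ := hqT ⟨x, hx⟩ x
      have := (hZ v hv).2 x hr
      simp only [Set.mem_Iic] at this
      linarith

/-! ### The extrapolation as an abstraction -/

section Extrapolation

variable {A : PTBA L P n} {S S' : SymState L P n}

theorem PTBA.exists_regionLE_of_mem_pkExtrapolation [Finite L]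
    (hS' : S' ∈ A.pkExtrapolation lb ub S)
    {η : ClockVal n} (hη : (v, η) ∈ S'.zone) :
    ∃ η₀, (v, η₀) ∈ S.zone ∧ RegionLE (A.maxConst lb ub) η η₀ := by
  obtain ⟨-, Z, hZ, hS, Z₁, h1, Z₂, h2, hZ₂⟩ := hS'
  rw [hZ₂] at hη
  have hr : ∀ v, Z₁.Refines lb ub v Z := fun v => CMatrix.refines_of_mem_canon h1
  obtain ⟨η₀, h3, h4⟩ := CMatrix.exists_mem_sem_of_mem_pkSplit A.maxConst_nonneg
    A.maxConst_zero (hZ.clocked.of_refines hr) h2 (CMatrix.triangle_of_mem_canon h1) hη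
  exact ⟨η₀, by rw [hS]; exact (hr v).mem_sem h3, h4⟩

theorem PTBA.pkExtrapolation_subset [Finite L] : A.pkExtrapolation lb ub S ⊆ symStates L n lb ub := by
  rintro S' ⟨-, Z, hZ, hS, Z₁, h1, Z₂, h2, hZ₂⟩
  exact ((hZ.clocked.of_refines fun v => CMatrix.refines_of_mem_canon h1).of_mem_pkSplit
    A.maxConst_nonneg h2).mem_symStates hZ₂

theorem PTBA.zone_subset_of_mem_pkExtrapolation (hS' : S' ∈ A.pkExtrapolation lb ub S)
    (hv : v ∈ S'.params) {η : ClockVal n} (hη : (v, η) ∈ S.zone) : (v, η) ∈ S'.zone := by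
  obtain ⟨-, Z, hZ, hS, Z₁, h1, Z₂, h2, hZ₂⟩ := hS'
  obtain ⟨η', hη'⟩ := hv
  rw [hZ₂] at hη' ⊢
  rw [hS] at hη
  have hv₁ := (CMatrix.slice_of_mem_pkSplit h2 hη'.1).1
  exact CMatrix.mem_sem.2 ⟨hη'.1, fun i j => CMatrix.slice_subset_of_mem_pkSplit h2 hη'.1 i j
    ((CMatrix.mem_sem_of_mem_canon h1 hη hv₁).2 i j)⟩

theorem PTBA.exists_mem_pkExtrapolation (A : PTBA L P n) (hS : S ∈ symStates L n lb ub)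
    {η : ClockVal n} (hη : (v, η) ∈ S.zone) :
    ∃ S' ∈ A.pkExtrapolation lb ub S, (v, η) ∈ S'.zone := by
  obtain ⟨Z, hZ, hSZ⟩ := hS
  rw [hSZ] at hη
  obtain ⟨Z₁, h1, hv₁⟩ := CMatrix.exists_mem_canon hη.1
  obtain ⟨Z₂, h2, hv₂⟩ := CMatrix.exists_mem_pkSplit (A.maxConst lb ub) hv₁
  exact ⟨⟨S.loc, Z₂.sem lb ub⟩, ⟨rfl, Z, hZ, hSZ, Z₁, h1, Z₂, h2, rfl⟩,
    CMatrix.mem_sem.2 ⟨hv₂, fun i j => CMatrix.slice_subset_of_mem_pkSplit h2 hv₂ i j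
      ((CMatrix.mem_sem_of_mem_canon h1 hη hv₁).2 i j)⟩⟩

theorem mem_Val_of_mem_symStates (hS : S ∈ symStates L n lb ub) {η : ClockVal n}
    (hη : (v, η) ∈ S.zone) : v ∈ Val lb ub := by
  obtain ⟨Z, -, hSZ⟩ := hS
  rw [hSZ] at hη
  exact hη.1.1

theorem PTBA.isAbstraction_pkExtrapolation [Finite L] (A : PTBA L P n) :
    A.IsAbstraction lb ub (A.pkExtrapolation lb ub) := by
  refine fun S hS => ⟨PTBA.pkExtrapolation_subset, fun S' hS' => ⟨hS'.1, ?_, ?_⟩, ?_, ?_⟩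
  · rintro v ⟨η, hη⟩
    obtain ⟨η₀, h, -⟩ := PTBA.exists_regionLE_of_mem_pkExtrapolation hS' hη
    exact ⟨η₀, h⟩
  · exact fun v hv η hη => PTBA.zone_subset_of_mem_pkExtrapolation hS' hv hη
  · rintro v ⟨η, hη⟩
    obtain ⟨S', h1, h2⟩ := A.exists_mem_pkExtrapolation hS hη
    exact ⟨S', h1, η, h2⟩
  · rintro S' hS' v ⟨l, η⟩ ⟨rfl, hη⟩
    obtain ⟨η₀, h1, h2⟩ := PTBA.exists_regionLE_of_mem_pkExtrapolation hS' hη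
    exact ⟨(S'.loc, η₀), ⟨hS'.1, h1⟩, PTBA.simulated_of_regionLE
      (mem_Val_of_mem_symStates hS h1) h2 S'.loc⟩

/-! ### Finiteness of the abstract system -/

theorem Bound.finite_sols (a b : ℤ) : {s : Set ℝ | ∃ e : Bound P, s = e.sols v ∧
    ExtExpr.eval e.expr v ≤ (b : WithTop ℤ) ∧ (a : WithTop ℤ) ≤ ExtExpr.eval e.expr v}.Finite := by
  refine Set.Finite.subset (((Set.finite_Icc a b).image fun z : ℤ => Set.Iic (z : ℝ)).union
    ((Set.finite_Icc a b).image fun z : ℤ => Set.Iio (z : ℝ))) ?_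
  rintro s ⟨e, rfl, h1, h2⟩
  induction e using Bound.shapes with
  | top s => simp at h1
  | le e =>
    rw [Bound.sols_le]
    exact Or.inl ⟨e.eval v, ⟨by simpa using h2, by simpa using h1⟩, rfl⟩
  | lt e =>
    rw [Bound.sols_lt]
    exact Or.inr ⟨e.eval v, ⟨by simpa using h2, by simpa using h1⟩, rfl⟩

theorem Val_finite (lb ub : P → ℤ) : (Val lb ub).Finite := by
  refine Set.Finite.subset (Set.Finite.pi' fun p => Set.finite_Icc (lb p) (ub p)) ?_
  exact fun v hv p => hv p

/-- Only finitely many sets of clock valuations arise by extrapolation for a given parameter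
valuation. -/
theorem CMatrix.exists_finite_pkSplit (M : Fin (n + 1) → ℤ) (v : P → ℤ) :
    ∃ 𝓕 : Set (Set (ClockVal n)), 𝓕.Finite ∧ ∀ (Z Z' : CMatrix n P), Z' ∈ Z.pkSplit M →
      {η | (v, η) ∈ Z'.sem lb ub} ∈ 𝓕 := by
  let B : Fin (n + 1) → Fin (n + 1) → Set (Set ℝ) := fun i j =>
    {s : Set ℝ | ∃ e : Bound P, s = e.sols v ∧ ExtExpr.eval e.expr v ≤ (M i : WithTop ℤ) ∧
      ((-M j : ℤ) : WithTop ℤ) ≤ ExtExpr.eval e.expr v} ∪ {Set.univ, Set.Iio (-M j : ℝ)}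
  have hB : ∀ i j, (B i j).Finite := fun i j => (Bound.finite_sols _ _).union (by simp)
  let F : (Fin (n + 1) → Fin (n + 1) → Set ℝ) → Set (ClockVal n) := fun s =>
    {η | ∀ i j, (η.1 i : ℝ) - η.1 j ∈ s i j}
  -- The empty set accounts for matrices whose constraints exclude `v`.
  refine ⟨insert ∅ (F '' {s | ∀ i, s i ∈ {t | ∀ j, t j ∈ B i j}}),
    ((Set.Finite.pi' fun i => Set.Finite.pi' (hB i)).image F).insert _, fun Z Z' h => ?_⟩
  by_cases hv : v ∈ semC lb ub Z'.C
  · refine Or.inr ⟨Z'.slice v, fun i j => ?_, ?_⟩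
    · rcases (CMatrix.slice_of_mem_pkSplit h hv).2 i j with ⟨h, h'⟩ | ⟨h, -⟩ | ⟨h, -⟩ <;> rw [h]
      · exact Or.inl ⟨_, rfl, h'⟩
      · exact Or.inr (Or.inl rfl)
      · exact Or.inr (Or.inr rfl)
    · ext η
      exact ⟨fun h => CMatrix.mem_sem.2 ⟨hv, h⟩, fun h => h.2⟩
  · refine Or.inl (Set.eq_empty_of_forall_notMem fun η hη => hv hη.1)

/-- Zones are sets and not matrices, so a state is determined by its location and its slices at the
finitely many `v ∈ Val lb ub`. -/
theorem PTBA.finite_absStates [Finite L] (A : PTBA L P n) :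
    (absStates lb ub (A.pkExtrapolation lb ub)).Finite := by
  choose 𝓕 hfin h𝓕 using CMatrix.exists_finite_pkSplit (lb := lb) (ub := ub) (P := P)
    (A.maxConst lb ub)
  have : Finite (Val lb ub) := (Val_finite lb ub).to_subtype
  let F : L × (Val lb ub → Set (ClockVal n)) → SymState L P n := fun x =>
    ⟨x.1, {y | ∃ h : y.1 ∈ Val lb ub, y.2 ∈ x.2 ⟨y.1, h⟩}⟩
  refine Set.Finite.subset ((Set.finite_univ.prod
    (Set.Finite.pi' fun w : Val lb ub => hfin w.1)).image F) ?_
  rintro ⟨l, Z'⟩ ⟨S, hS, rfl, Z, hZ, hSZ, Z₁, h1, Z₂, h2, rfl⟩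
  refine ⟨(S.loc, fun w => {η | (w.1, η) ∈ Z₂.sem lb ub}),
    ⟨trivial, fun w => h𝓕 w.1 Z₁ Z₂ h2⟩, ?_⟩
  simp only [F, SymState.mk.injEq, true_and]
  ext ⟨v, η⟩
  exact ⟨fun ⟨_, h⟩ => h, fun h => ⟨h.1.1, h⟩⟩

theorem PTBA.isFiniteAbstraction_pkExtrapolation [Finite L] (A : PTBA L P n) :
    A.IsFiniteAbstraction lb ub (A.pkExtrapolation lb ub) := by
  refine ⟨A.isAbstraction_pkExtrapolation, ?_, A.finite_absStates⟩
  refine (A.finite_absStates (lb := lb) (ub := ub)).finite_subsets.subset ?_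
  rintro _ ⟨S, hS, rfl⟩ Q hQ
  exact ⟨S, hS, hQ⟩

end Extrapolation

end ParTimed

namespace ParTimed

variable {L P : Type*} [Fintype P] {n : ℕ} {lb ub v : P → ℤ}

/-! ### From concrete runs to abstract runs -/

theorem PTBA.absHasAcceptingRun_of_hasAcceptingRun [Finite L] {A : PTBA L P n} (hv : v ∈ Val lb ub)
    (h : A.HasAcceptingRun v) : A.AbsHasAcceptingRun lb ub (A.pkExtrapolation lb ub) v := by
  obtain ⟨s, s', d, h0, hd, ha, hacc⟩ := h
  have hs' : ∀ k, s' k = ((s k).1, (s k).2.delay (d k)) := fun k =>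
    Prod.ext (hd k).1.symm (hd k).2.1
  -- The states of the abstract run contain the concrete states after the delays.
  let Good : ℕ → SymState L P n → Prop := fun k Q =>
    Q ∈ absStates lb ub (A.pkExtrapolation lb ub) ∧ Q.loc = (s k).1 ∧ (v, (s' k).2) ∈ Q.zone
  have hinit : ∃ Q, Good 0 Q ∧ Q ∈ A.absInit lb ub (A.pkExtrapolation lb ub) := by
    have h1 := (hd 0).2.2
    rw [hs' 0, h0] at h1
    obtain ⟨S, hS, hη⟩ := PTBA.exists_mem_symInit hv (d 0) h1
    obtain ⟨Q, hQ, hη'⟩ := A.exists_mem_pkExtrapolation (PTBA.symInit_subset hS) hη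
    refine ⟨Q, ⟨⟨S, PTBA.symInit_subset hS, hQ⟩, ?_, ?_⟩, S, hS, hQ⟩
    · rw [hQ.1, hS.1, h0]
    · rw [hs' 0, h0]
      exact hη'
  have hstep : ∀ k Q, Good k Q → ∃ Q', Good (k + 1) Q' ∧
      A.AbsTrans lb ub (A.pkExtrapolation lb ub) Q Q' := by
    rintro k Q ⟨⟨S₀, -, hQ⟩, hloc, hη⟩
    obtain ⟨g, R, ht, hg, hr, -⟩ := ha k
    have hl : (s' k).1 = Q.loc := by rw [hs' k, hloc]
    have h1 := (hd (k + 1)).2.2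
    rw [hs' (k + 1)] at h1
    rw [hl] at ht
    rw [hr] at h1
    obtain ⟨S, hS, hT, hSl, hSη⟩ := PTBA.exists_symTrans (PTBA.pkExtrapolation_subset hQ) hη ht hg
      (d (k + 1)) h1
    obtain ⟨Q', hQ', hη'⟩ := A.exists_mem_pkExtrapolation hS hSη
    refine ⟨Q', ⟨⟨S, hS, hQ'⟩, hQ'.1.trans hSl, ?_⟩, S, hS, hQ', hT⟩
    rw [hs' (k + 1), hr]
    exact hη'
  obtain ⟨Q₀, hQ₀, hQ₀'⟩ := hinit
  choose! next hnext using hstep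
  let Q : ℕ → SymState L P n := fun k => Nat.rec Q₀ (fun k q => next k q) k
  have hgood : ∀ k, Good k (Q k) := by
    intro k
    induction k with
    | zero => exact hQ₀
    | succ k ih => exact (hnext k _ ih).1
  refine ⟨Q, hQ₀', fun k => (hgood k).1, fun k => (hnext k _ (hgood k)).2,
    fun k => ⟨_, (hgood k).2.2⟩, ?_⟩
  convert hacc using 3 with k
  rw [(hgood k).2.1]

/-! ### From abstract runs to concrete runs -/

/-- A discrete step along the edge with guard `g`, reset set `R` and target invariant `I`, followed
by a delay. -/
def EdgeStep (v : P → ℤ) (g : SimpleGuard n P) (R : Finset (Fin (n + 1))) (I : SimpleGuard n P)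
    (η η' : ClockVal n) : Prop :=
  g.Sat v η ∧ I.Sat v (η.reset R) ∧ (∃ d, η' = (η.reset R).delay d) ∧ I.Sat v η'

theorem RegionLE.edgeStep [Finite L] {A : PTBA L P n} (hv : v ∈ Val lb ub)
    {η₁ η₂ η₁' : ClockVal n} (h : RegionLE (A.maxConst lb ub) η₁ η₂) {l l' : L}
    {g : SimpleGuard n P} {R : Finset (Fin (n + 1))} (ht : (l, g, R, l') ∈ A.edges)
    (hs : EdgeStep v g R (A.inv l') η₁ η₁') :
    ∃ η₂', EdgeStep v g R (A.inv l') η₂ η₂' ∧ RegionLE (A.maxConst lb ub) η₁' η₂' := by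
  obtain ⟨hg, hi, ⟨d, rfl⟩, hi'⟩ := hs
  obtain ⟨d', hd'⟩ := (h.reset R).delay d
  exact ⟨_, ⟨h.guard_sat hv ht hg, (h.reset R).inv_sat hv hi, ⟨d', rfl⟩, hd'.inv_sat hv hi'⟩, hd'⟩

/-- `m` successive steps of the sequence `T` of relations, from the `k`-th one on, are possible. -/
def CanRun {X : Type*} (T : ℕ → X → X → Prop) : ℕ → ℕ → X → Prop
  | _, 0, _ => True
  | k, m + 1, x => ∃ y, T k x y ∧ CanRun T (k + 1) m y

theorem CanRun.mono {X : Type*} {T : ℕ → X → X → Prop} {k m m' : ℕ} {x : X} (hm : m' ≤ m)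
    (h : CanRun T k m x) : CanRun T k m' x := by
  induction m' generalizing k m x with
  | zero => trivial
  | succ m' ih =>
    obtain ⟨m, rfl⟩ : ∃ j, m = j + 1 := ⟨m - 1, by omega⟩
    obtain ⟨y, hy, hy'⟩ := h
    exact ⟨y, hy, ih (by omega) hy'⟩

theorem CanRun.of_simulation {X : Type*} {T : ℕ → X → X → Prop} {r : X → X → Prop}
    (hr : ∀ k x x' y, r x x' → T k x y → ∃ y', T k x' y' ∧ r y y') {m k : ℕ} {x x' : X}
    (hx : r x x') (h : CanRun T k m x) : CanRun T k m x' := by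
  induction m generalizing k x x' with
  | zero => trivial
  | succ m ih =>
    obtain ⟨y, hy, hy'⟩ := h
    obtain ⟨y', h1, h2⟩ := hr k x x' y hx hy
    exact ⟨y', h1, ih h2 hy'⟩

/-- Arbitrarily long finite runs along a sequence of relations can be combined to an infinite one if
the relations respect a preorder with finitely many classes. -/
theorem exists_infinite_run {X Y : Type*} {T : ℕ → X → X → Prop} {r : X → X → Prop}
    (hr : ∀ k x x' y, r x x' → T k x y → ∃ y', T k x' y' ∧ r y y') (f : X → Y)
    (hf : (Set.range f).Finite) (hfr : ∀ x x', f x = f x' → r x x') (p : X → Prop)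
    (hp : ∀ m, ∃ x, p x ∧ CanRun T 0 m x) :
    ∃ x : ℕ → X, p (x 0) ∧ ∀ k, T k (x k) (x (k + 1)) := by
  have hpigeon : ∀ k (p : X → Prop), (∀ m, ∃ x, p x ∧ CanRun T k m x) →
      ∃ x, p x ∧ ∀ m, CanRun T k m x := by
    intro k p h
    choose x hx hx' using h
    have : Finite (Set.range f) := hf.to_subtype
    -- One class contains the starting points of arbitrarily long runs, so each member of it can
    -- imitate them all.
    obtain ⟨c, hc⟩ := Finite.exists_infinite_fiber fun m => (⟨f (x m), x m, rfl⟩ : Set.range f)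
    rw [Set.infinite_coe_iff] at hc
    obtain ⟨m₀, hm₀⟩ := hc.nonempty
    refine ⟨x m₀, hx m₀, fun m => ?_⟩
    obtain ⟨m', hm', hlt⟩ := hc.exists_gt m
    refine (CanRun.of_simulation hr (hfr _ _ ?_) (hx' m')).mono hlt.le
    have h1 : (⟨f (x m'), x m', rfl⟩ : Set.range f) = c := hm'
    have h2 : (⟨f (x m₀), x m₀, rfl⟩ : Set.range f) = c := hm₀
    exact congrArg Subtype.val (h1.trans h2.symm)
  obtain ⟨x₀, hx₀, hx₀'⟩ := hpigeon 0 p hp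
  have hstep : ∀ k x, (∀ m, CanRun T k m x) → ∃ y, T k x y ∧ ∀ m, CanRun T (k + 1) m y :=
    fun k x h => hpigeon (k + 1) (T k x) fun m => h (m + 1)
  choose! next hnext using hstep
  let x : ℕ → X := fun k => Nat.rec x₀ (fun k q => next k q) k
  have hgood : ∀ k m, CanRun T k m (x k) := by
    intro k
    induction k with
    | zero => exact hx₀'
    | succ k ih => exact (hnext k _ ih).2
  exact ⟨x, hx₀, fun k => (hnext k _ (hgood k)).1⟩

/-- Points of `Q (k + 1)` are related to points of `S k`, which have predecessors in `Q k`. So runs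
of each finite length along the path are built from their last state backwards, and combined by
`exists_infinite_run`. -/
theorem PTBA.hasAcceptingRun_of_absHasAcceptingRun [Finite L] {A : PTBA L P n} (hv : v ∈ Val lb ub)
    (hinv : A.InvariantsHoldOnEntry v)
    (h : A.AbsHasAcceptingRun lb ub (A.pkExtrapolation lb ub) v) : A.HasAcceptingRun v := by
  obtain ⟨Q, ⟨S₀, hS₀, hQ₀⟩, -, hT, hpar, hacc⟩ := h
  choose S hS hQS hST using hT
  choose g R hedge hpred using fun k => (hST k).exists_pred
  have hloc : ∀ k, (Q (k + 1)).loc = (S k).loc := fun k => (hQS k).1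
  -- Extrapolation adds only valuations related to old ones, and by symmetry these satisfy the same
  -- invariants.
  have hQinv : ∀ k η, (v, η) ∈ (Q k).zone → (A.inv (Q k).loc).Sat v η := by
    intro k η hη
    cases k with
    | zero =>
      obtain ⟨η₀, h1, h2⟩ := PTBA.exists_regionLE_of_mem_pkExtrapolation hQ₀ hη
      refine h2.symm.inv_sat hv ?_
      rw [hQ₀.1, hS₀.1]
      exact (PTBA.mem_symInit_spec hS₀ hv h1).2
    | succ k =>
      obtain ⟨η₀, h1, h2⟩ := PTBA.exists_regionLE_of_mem_pkExtrapolation (hQS k) hη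
      refine h2.symm.inv_sat hv ?_
      obtain ⟨-, -, -, -, -, h3⟩ := hpred k v η₀ h1
      rwa [hloc k]
  let T : ℕ → ClockVal n → ClockVal n → Prop := fun k =>
    EdgeStep v (g k) (R k) (A.inv (S k).loc)
  have hTsim : ∀ k η₁ η₂ η₁', RegionLE (A.maxConst lb ub) η₁ η₂ → T k η₁ η₁' →
      ∃ η₂', T k η₂ η₂' ∧ RegionLE (A.maxConst lb ub) η₁' η₂' :=
    fun k η₁ η₂ η₁' h hs => h.edgeStep hv (hedge k) hs
  have hcan : ∀ m k, ∃ η, (v, η) ∈ (Q k).zone ∧ CanRun T k m η := by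
    intro m
    induction m with
    | zero => exact fun k => (hpar k).imp fun η h => ⟨h, trivial⟩
    | succ m ih =>
      intro k
      obtain ⟨η', h1, h2⟩ := ih (k + 1)
      obtain ⟨η₁, h3, h4⟩ := PTBA.exists_regionLE_of_mem_pkExtrapolation (hQS k) h1
      obtain ⟨η, d, h5, h6, h7, h8⟩ := hpred k v η₁ h3
      -- The proviso supplies the invariant right after the reset from its validity after the delay.
      exact ⟨η, h5, η₁, ⟨h6, hinv _ _ _ _ (hedge k) η d (hQinv k η h5) h6 (h7 ▸ h8), ⟨d, h7⟩, h8⟩,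
        CanRun.of_simulation hTsim h4 h2⟩
  obtain ⟨f, hf, hfr⟩ := exists_regionClass (A.maxConst lb ub) A.maxConst_nonneg A.maxConst_zero
  obtain ⟨x, ⟨⟨d₀, hd₀⟩, hx₀⟩, hx⟩ := exists_infinite_run hTsim f hf hfr
    (fun η => (∃ d, η = (ClockVal.zero n).delay d) ∧ (A.inv A.init).Sat v η) fun m => by
      obtain ⟨η, h1, h2⟩ := hcan m 0
      obtain ⟨η₀, h3, h4⟩ := PTBA.exists_regionLE_of_mem_pkExtrapolation hQ₀ h1
      exact ⟨η₀, PTBA.mem_symInit_spec hS₀ hv h3, CanRun.of_simulation hTsim h4 h2⟩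
  choose d hd using fun k => (hx k).2.2.1
  have hQ0 : (Q 0).loc = A.init := by rw [hQ₀.1, hS₀.1]
  -- The valuation `x k` is the one after the `k`-th delay. States before a delay are therefore
  -- shifted by one: the zero valuation, then the resets of the `x k`.
  refine ⟨fun k => Nat.casesOn k (A.init, ClockVal.zero n)
      fun k => ((Q (k + 1)).loc, (x k).reset (R k)),
    fun k => ((Q k).loc, x k), fun k => Nat.casesOn k d₀ d, rfl, fun k => ?_, fun k => ?_, ?_⟩
  · cases k with
    | zero => exact ⟨hQ0.symm, hd₀, (congrArg A.inv hQ0).symm ▸ hx₀⟩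
    | succ k => exact ⟨rfl, hd k, (congrArg A.inv (hloc k)).symm ▸ (hx k).2.2.2⟩
  · refine ⟨g k, R k, ?_, (hx k).1, rfl, ?_⟩
    · change ((Q k).loc, g k, R k, (Q (k + 1)).loc) ∈ A.edges
      rw [hloc k]
      exact hedge k
    · change (A.inv (Q (k + 1)).loc).Sat v ((x k).reset (R k))
      rw [hloc k]
      exact (hx k).2.1
  · convert hacc using 3 with k
    cases k with
    | zero => exact iff_of_eq (congrArg (· ∈ A.acc) hQ0.symm)
    | succ k => rfl

end ParTimed

theorem theorem1 {L P : Type*} [Finite L] [Fintype P] {n : ℕ} (A : ParTimed.PTBA L P n)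
    (lb ub : P → ℤ) :
    A.IsFiniteAbstraction lb ub (A.pkExtrapolation lb ub) ∧
    ∀ v ∈ ParTimed.Val lb ub,
      (A.HasAcceptingRun v → A.AbsHasAcceptingRun lb ub (A.pkExtrapolation lb ub) v) ∧
      (A.InvariantsHoldOnEntry v →
        A.AbsHasAcceptingRun lb ub (A.pkExtrapolation lb ub) v → A.HasAcceptingRun v) := by
  refine ⟨A.isFiniteAbstraction_pkExtrapolation, fun v hv => ⟨?_, ?_⟩⟩
  · exact ParTimed.PTBA.absHasAcceptingRun_of_hasAcceptingRun hv
  · exact ParTimed.PTBA.hasAcceptingRun_of_absHasAcceptingRun hv
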